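/- Let $\Lambda,u_0\in\mathbb R$, let $S\subset\mathbb R^2$ be open and nonempty, let $P(u,x,y)>0$ be smooth on $(u_0,\infty)\times S$, and let $m(u),q(u),C_1(u)$ be smooth on $(u_0,\infty)$ with $q(u)\neq 0$ for all $u$. Write $\Delta=P^2(\partial_{xx}+\partial_{yy})$. For a function $Q(u,r)$ consider the metric $$ds^2=-\Big(\Delta\ln P-2r(\ln P)_{,u}-\tfrac{2m}{r}-\tfrac{\Lambda}{3}r^2+Q\Big)du^2-2\,du\,dr+\frac{r^2}{P^2}(dx^2+dy^2),$$ and a Maxwell 2-form $E(u,r)\,du\wedge dr$ (that is, $F_{ur}=-F_{ru}=E$) with invariant $F=F_{\mu\nu}F^{\mu\nu}$. The field equations for a Lagrangian $\mathcal L(F)$ are $$G^\mu{}_\nu=\tfrac12\{\delta^\mu_\nu\mathcal L-4F_{\nu\lambda}F^{\mu\lambda}\mathcal L_F\}-\Lambda\delta^\mu_\nu,\qquad dF_{(2)}=0,\qquad \partial_\mu(\sqrt{-g}\,\mathcal L_FF^{\mu\nu})=0,$$ where $F_{(2)}$ denotes the 2-form. Indefinite integrals $\int w(r,q)\,dr$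 below denote any primitive $\kappa q^3+\int_0^r w(s,q)\,ds$ with $\kappa\in\mathbb R$ constant. Let $\alpha,\beta>0$. For each of the following models there are smooth 2-forms $E\,du\wedge dr$ with the listed invariant $F$, and each of them, together with the metric with the listed $Q$, solves the field equations on the stated range (with $u>u_0$, $(x,y)\in S$) if and only if $$\Delta\Delta\ln P+12M(\ln P)_{,u}-4M_{,u}=0\ \text{ with } M=m-\tfrac{C_1}{2},\qquad\text{and}\qquad qP_{,u}-q_{,u}P=0 .$$ 1. Maxwell, $\mathcal L=-F$, $r>0$: $F=-\dfrac{2q^4}{r^4}$, $Q=\dfrac{q^4}{r^2}+\dfrac{C_1}{r}$. 2. Born–Infeld, $\mathcal L=4\beta^2\big(1-\sqrt{1+F/(2\beta^2)}\big)$, $r>0$: $F=-\dfrac{2q^4}{r^4+q^4/\beta^2}$, $Q=\dfrac{C_1}{r}+\dfrac{2\beta^2}{3}r^2-\dfrac{2\beta^2}{r}\displaystyle\int\sqrt{r^4+q^4/\beta^2}\,dr$. 3. Logarithmic, $\mathcal L=-8\beta^2\ln\big(1+F/(8\beta^2)\big)$, $r>0$: $F=-\dfrac{8\beta^2}{q^4}\big(\beta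 r^2-\sqrt{\beta^2r^4+q^4}\big)^2$, $$Q=\frac{C_1}{r}+\frac{20}{9}\beta^2r^2-4\beta\sqrt{\beta^2r^4+q^4}-\frac43\beta^2r^2\ln\!\Big(\frac{-2\beta^2r^4+2\beta r^2\sqrt{\beta^2r^4+q^4}}{q^4}\Big)+\frac{16\beta^3}{3r}\int\frac{r^4}{\sqrt{\beta^2r^4+q^4}}\,dr.$$ 4. New Lagrangian 1, $\mathcal L=-\frac{2}{\alpha^4}\ln(1-\alpha^2\sqrt{-F})-\frac{2\sqrt{-F}}{\alpha^2}$ with $\beta^2=\sqrt2\,\alpha^2$, $r>0$: $F=-\dfrac{2q^4}{(r^2+q^2\beta^2)^2}$, $$Q=\frac{C_1}{r}-\frac23\frac{q^2}{\beta^2}-\frac43\frac{q^3}{r\beta}\arctan\frac{r}{q\beta}-\frac{2r^2}{3\beta^4}\ln\frac{r^2}{r^2+q^2\beta^2}.$$ 5. New Lagrangian 2, $\mathcal L=\dfrac{1}{\beta-\sqrt{-F}}$, $q>0$, $r>0$, $\beta q(u)-2r>0$: $F=-\dfrac{(\beta q-r)^2}{q^2}$, $Q=\dfrac{C_1}{r}-\dfrac{\beta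 q^2}{2}+\dfrac{q}{2}r$. Moreover, for Born–Infeld the constraint $(\ln P)_{,u}\{rQ_{,r}-2Q\}+Q_{,u}=0$ (for all $u>u_0$, $r>0$, $(x,y)\in S$) forces $C_1=0$ up to the choice of the constant $\kappa$ in the indefinite integral: it holds if and only if $qP_{,u}=q_{,u}P$ and $Q$ equals the same expression with $C_1=0$ and some constant $\kappa'$ in place of $\kappa$. When it holds, the equation $\Delta\Delta\ln P+12M(\ln P)_{,u}-4M_{,u}=0$ with $M=m-C_1/2$ is equivalent to the same equation with $M=m$. -/

import Mathlib

open scoped ContDiff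

noncomputable section

namespace RobinsonTrautman

/-! ### Tensor calculus in a coordinate chart of a four-dimensional spacetime

Points are given by their coordinates `p : Fin 4 → ℝ`; in the Robinson-Trautman chart
`p 0 = u`, `p 1 = r`, `p 2 = x`, `p 3 = y`. -/

/-- Partial derivative of `f` in the `i`-th coordinate. -/
def pd (i : Fin 4) (f : (Fin 4 → ℝ) → ℝ) (p : Fin 4 → ℝ) : ℝ :=
  deriv (fun t => f (Function.update p i t)) (p i)

/-- A field of `4 × 4` matrices: the components of a tensor with two lower indices. -/
abbrev TensorField := (Fin 4 → ℝ) → Matrix (Fin 4) (Fin 4) ℝ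

/-- Christoffel symbols `Γ^a_{bc}` of the metric `g`. -/
def christoffel (g : TensorField) (a b c : Fin 4) (p : Fin 4 → ℝ) : ℝ :=
  (1 / 2) * ∑ d, (g p)⁻¹ a d *
    (pd b (fun z => g z d c) p + pd c (fun z => g z d b) p - pd d (fun z => g z b c) p)

/-- Ricci tensor `R_{bc} = ∂_a Γ^a_{bc} - ∂_c Γ^a_{ba} + Γ^a_{ad} Γ^d_{bc} - Γ^a_{cd} Γ^d_{ba}`. -/
def ricci (g : TensorField) (b c : Fin 4) (p : Fin 4 → ℝ) : ℝ :=
  ∑ a, (pd a (christoffel g a b c) p - pd c (christoffel g a b a) p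
    + ∑ d, (christoffel g a a d p * christoffel g d b c p
      - christoffel g a c d p * christoffel g d b a p))

/-- Mixed Ricci tensor `R^μ_ν`. -/
def ricciMixed (g : TensorField) (μ ν : Fin 4) (p : Fin 4 → ℝ) : ℝ :=
  ∑ a, (g p)⁻¹ μ a * ricci g a ν p

/-- Ricci scalar. -/
def scalarCurvature (g : TensorField) (p : Fin 4 → ℝ) : ℝ :=
  ∑ a, ricciMixed g a a p

/-- Mixed Kronecker delta `δ^μ_ν`. -/
def delta (μ ν : Fin 4) : ℝ := if μ = ν then 1 else 0

/-- Mixed Einstein tensor `G^μ_ν = R^μ_ν - (1/2) R δ^μ_ν`. -/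
def einstein (g : TensorField) (μ ν : Fin 4) (p : Fin 4 → ℝ) : ℝ :=
  ricciMixed g μ ν p - (1 / 2) * scalarCurvature g p * delta μ ν

/-! ### Nonlinear electrodynamics -/

/-- Components `F^{μν}` of a 2-form given by its lower components `F_{μν}`. -/
def raised (g A : TensorField) (μ ν : Fin 4) (p : Fin 4 → ℝ) : ℝ :=
  ∑ a, ∑ b, (g p)⁻¹ μ a * (g p)⁻¹ ν b * A p a b

/-- The field invariant `F = F_{μν} F^{μν}`. -/
def fieldInvariant (g A : TensorField) (p : Fin 4 → ℝ) : ℝ :=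
  ∑ μ, ∑ ν, A p μ ν * raised g A μ ν p

/-- Energy-momentum tensor
`T^μ_ν = (1/2) (δ^μ_ν 𝓛(F) - 4 F_{νl} F^{μl} 𝓛_F(F))` of the Lagrangian `L`. -/
def energyMomentum (L : ℝ → ℝ) (g A : TensorField) (μ ν : Fin 4) (p : Fin 4 → ℝ) : ℝ :=
  (1 / 2) * (delta μ ν * L (fieldInvariant g A p)
    - 4 * (∑ l, A p ν l * raised g A μ l p) * deriv L (fieldInvariant g A p))

/-- The field equations of gravity with cosmological constant `Λ` coupled to nonlinear
electrodynamics with Lagrangian `L`, on the coordinate domain `D`: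
the Einstein equations `G^μ_ν = T^μ_ν - Λ δ^μ_ν`, the closedness of the Maxwell 2-form, and the
modified Maxwell equations `∂_μ (√(-g) 𝓛_F F^{μν}) = 0`. -/
def FieldEquations (Λ : ℝ) (L : ℝ → ℝ) (g A : TensorField) (D : Set (Fin 4 → ℝ)) : Prop :=
  ∀ p ∈ D,
    (∀ μ ν, einstein g μ ν p = energyMomentum L g A μ ν p - Λ * delta μ ν) ∧
    (∀ a b c, pd a (fun z => A z b c) p + pd b (fun z => A z c a) p
      + pd c (fun z => A z a b) p = 0) ∧
    (∀ ν, ∑ μ, pd μ (fun z => Real.sqrt (-(g z).det) * deriv L (fieldInvariant g A z)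
      * raised g A μ ν z) p = 0)

/-! ### The Robinson-Trautman ansatz -/

/-- `ln P` as a function of `(u, x, y)`. -/
def logP (P : ℝ → ℝ → ℝ → ℝ) (u x y : ℝ) : ℝ := Real.log (P u x y)

/-- `(ln P)_{,u}`. -/
def logPu (P : ℝ → ℝ → ℝ → ℝ) (u x y : ℝ) : ℝ := deriv (fun v => logP P v x y) u

/-- The operator `Δ = P² (∂_xx + ∂_yy)`. -/
def lap (P f : ℝ → ℝ → ℝ → ℝ) (u x y : ℝ) : ℝ :=
  P u x y ^ 2 * (iteratedDeriv 2 (fun s => f u s y) x + iteratedDeriv 2 (fun s => f u x s) y)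

/-- `2H = Δ ln P - 2 r (ln P)_{,u} - 2m/r - (Λ/3) r²`. -/
def twoH (Λ : ℝ) (P : ℝ → ℝ → ℝ → ℝ) (m : ℝ → ℝ) (u r x y : ℝ) : ℝ :=
  lap P (logP P) u x y - 2 * r * logPu P u x y - 2 * m u / r - Λ / 3 * r ^ 2

/-- The metric
`ds² = -(2H + Q) du² - 2 du dr + (r²/P²) (dx² + dy²)`. -/
def metric (Λ : ℝ) (P : ℝ → ℝ → ℝ → ℝ) (m : ℝ → ℝ) (Q : ℝ → ℝ → ℝ) : TensorField := fun p =>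
  !![-(twoH Λ P m (p 0) (p 1) (p 2) (p 3) + Q (p 0) (p 1)), -1, 0, 0;
     -1, 0, 0, 0;
     0, 0, p 1 ^ 2 / P (p 0) (p 2) (p 3) ^ 2, 0;
     0, 0, 0, p 1 ^ 2 / P (p 0) (p 2) (p 3) ^ 2]

/-- The Maxwell 2-form `E(u,r) du ∧ dr`. -/
def faraday (E : ℝ → ℝ → ℝ) : TensorField := fun p =>
  !![0, E (p 0) (p 1), 0, 0;
     -E (p 0) (p 1), 0, 0, 0;
     0, 0, 0, 0;
     0, 0, 0, 0]

/-- The coordinate domain: `(u, r) ∈ B` and `(x, y) ∈ S`. -/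
def domain (B S : Set (ℝ × ℝ)) : Set (Fin 4 → ℝ) :=
  {p | (p 0, p 1) ∈ B ∧ (p 2, p 3) ∈ S}

/-- The half plane `u > u₀`, `r > 0`. -/
def fullRange (u₀ : ℝ) : Set (ℝ × ℝ) := {z | u₀ < z.1 ∧ 0 < z.2}

/-- The range `u > u₀`, `0 < r < β q(u) / 2`. -/
def innerRange (u₀ β : ℝ) (q : ℝ → ℝ) : Set (ℝ × ℝ) :=
  {z | u₀ < z.1 ∧ 0 < z.2 ∧ 0 < β * q z.1 - 2 * z.2}

/-- The Robinson-Trautman equation `ΔΔ ln P + 12 M (ln P)_{,u} - 4 M_{,u} = 0`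
for the mass function `M`. -/
def RTEquation (u₀ : ℝ) (S : Set (ℝ × ℝ)) (P : ℝ → ℝ → ℝ → ℝ) (M : ℝ → ℝ) : Prop :=
  ∀ u x y, u₀ < u → (x, y) ∈ S →
    lap P (lap P (logP P)) u x y + 12 * M u * logPu P u x y - 4 * deriv M u = 0

/-- The restriction `q P_{,u} - q_{,u} P = 0`. -/
def ChargeRestriction (u₀ : ℝ) (S : Set (ℝ × ℝ)) (P : ℝ → ℝ → ℝ → ℝ) (q : ℝ → ℝ) : Prop :=
  ∀ u x y, u₀ < u → (x, y) ∈ S →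
    q u * deriv (fun v => P v x y) u - deriv q u * P u x y = 0

/-- The constraint `(ln P)_{,u} (r Q_{,r} - 2Q) + Q_{,u} = 0`. -/
def Constraint (B S : Set (ℝ × ℝ)) (P : ℝ → ℝ → ℝ → ℝ) (Q : ℝ → ℝ → ℝ) : Prop :=
  ∀ u r x y, (u, r) ∈ B → (x, y) ∈ S →
    logPu P u x y * (r * deriv (fun s => Q u s) r - 2 * Q u r) + deriv (fun v => Q v r) u = 0

/-- Smooth, positive/nonvanishing data for the ansatz over `u > u₀` and a nonempty open set `S`
of the coordinates `(x, y)`. -/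
structure AdmissibleData (u₀ : ℝ) (S : Set (ℝ × ℝ)) (P : ℝ → ℝ → ℝ → ℝ) (m q C₁ : ℝ → ℝ) :
    Prop where
  isOpen : IsOpen S
  nonempty : S.Nonempty
  smooth_P : ContDiffOn ℝ ∞ (fun z : ℝ × ℝ × ℝ => P z.1 z.2.1 z.2.2) (Set.Ioi u₀ ×ˢ S)
  pos_P : ∀ u x y, u₀ < u → (x, y) ∈ S → 0 < P u x y
  smooth_m : ContDiffOn ℝ ∞ m (Set.Ioi u₀)
  smooth_q : ContDiffOn ℝ ∞ q (Set.Ioi u₀)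
  smooth_C₁ : ContDiffOn ℝ ∞ C₁ (Set.Ioi u₀)
  q_ne_zero : ∀ u, u₀ < u → q u ≠ 0

/-- For the metric with function `Q` and the Lagrangian `L`: there are smooth Maxwell 2-forms
`E(u,r) du ∧ dr` with field invariant `F_{μν} F^{μν} = Finv(u,r)`, and each of them, with the
metric, solves the field equations if and only if the Robinson-Trautman equation with
`M = m - C₁/2` and `q P_{,u} = q_{,u} P` hold. -/
def SolvesExactlyWhenRestricted (Λ u₀ : ℝ) (B S : Set (ℝ × ℝ)) (L : ℝ → ℝ)
    (Finv Q : ℝ → ℝ → ℝ) (P : ℝ → ℝ → ℝ → ℝ) (m q C₁ : ℝ → ℝ) : Prop :=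
  (∃ E : ℝ → ℝ → ℝ, ContDiffOn ℝ ∞ (fun z : ℝ × ℝ => E z.1 z.2) B ∧
    ∀ p ∈ domain B S, fieldInvariant (metric Λ P m Q) (faraday E) p = Finv (p 0) (p 1)) ∧
  ∀ E : ℝ → ℝ → ℝ, ContDiffOn ℝ ∞ (fun z : ℝ × ℝ => E z.1 z.2) B →
    (∀ p ∈ domain B S, fieldInvariant (metric Λ P m Q) (faraday E) p = Finv (p 0) (p 1)) →
    (FieldEquations Λ L (metric Λ P m Q) (faraday E) (domain B S) ↔
      RTEquation u₀ S P (fun u => m u - C₁ u / 2) ∧ ChargeRestriction u₀ S P q)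

/-! ### The models

The remaining indefinite integrals `∫ w(r, q) dr` are taken to be the primitives
`κ q³ + ∫_0^r w(s, q) ds` with a constant `κ`; the term `C₁(u)/r` accounts for all others. -/

def maxwellL (F : ℝ) : ℝ := -F

def maxwellF (q : ℝ → ℝ) (u r : ℝ) : ℝ := -2 * q u ^ 4 / r ^ 4

def maxwellQ (q C₁ : ℝ → ℝ) (u r : ℝ) : ℝ := q u ^ 4 / r ^ 2 + C₁ u / r

def bornInfeldL (β F : ℝ) : ℝ := 4 * β ^ 2 * (1 - Real.sqrt (1 + F / (2 * β ^ 2)))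

def bornInfeldF (β : ℝ) (q : ℝ → ℝ) (u r : ℝ) : ℝ :=
  -(2 * q u ^ 4 / (r ^ 4 + q u ^ 4 / β ^ 2))

def bornInfeldQ (β κ : ℝ) (q C₁ : ℝ → ℝ) (u r : ℝ) : ℝ :=
  C₁ u / r + 2 * β ^ 2 / 3 * r ^ 2
    - 2 * β ^ 2 / r * (κ * q u ^ 3 + ∫ s in (0 : ℝ)..r, Real.sqrt (s ^ 4 + q u ^ 4 / β ^ 2))

def logarithmicL (β F : ℝ) : ℝ := -8 * β ^ 2 * Real.log (1 + F / (8 * β ^ 2))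

def logarithmicF (β : ℝ) (q : ℝ → ℝ) (u r : ℝ) : ℝ :=
  -(8 * β ^ 2 / q u ^ 4 * (β * r ^ 2 - Real.sqrt (β ^ 2 * r ^ 4 + q u ^ 4)) ^ 2)

def logarithmicQ (β κ : ℝ) (q C₁ : ℝ → ℝ) (u r : ℝ) : ℝ :=
  C₁ u / r + 20 / 9 * β ^ 2 * r ^ 2 - 4 * β * Real.sqrt (r ^ 4 * β ^ 2 + q u ^ 4)
    - 4 / 3 * β ^ 2 * r ^ 2 *
      Real.log ((-2 * r ^ 4 * β ^ 2 + 2 * β * r ^ 2 * Real.sqrt (r ^ 4 * β ^ 2 + q u ^ 4))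
        / q u ^ 4)
    + 16 * β ^ 3 / (3 * r) *
      (κ * q u ^ 3 + ∫ s in (0 : ℝ)..r, s ^ 4 / Real.sqrt (s ^ 4 * β ^ 2 + q u ^ 4))

def new1L (α F : ℝ) : ℝ :=
  -(2 / α ^ 4) * Real.log (1 - α ^ 2 * Real.sqrt (-F)) - 2 * Real.sqrt (-F) / α ^ 2

def new1F (β : ℝ) (q : ℝ → ℝ) (u r : ℝ) : ℝ :=
  -(2 * q u ^ 4 / (r ^ 2 + q u ^ 2 * β ^ 2) ^ 2)

def new1Q (β : ℝ) (q C₁ : ℝ → ℝ) (u r : ℝ) : ℝ :=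
  C₁ u / r - 2 / 3 * (q u ^ 2 / β ^ 2)
    - 4 / 3 * (q u ^ 3 / (r * β)) * Real.arctan (r / (q u * β))
    - 2 * r ^ 2 / (3 * β ^ 4) * Real.log (r ^ 2 / (r ^ 2 + q u ^ 2 * β ^ 2))

def new2L (β F : ℝ) : ℝ := 1 / (β - Real.sqrt (-F))

def new2F (β : ℝ) (q : ℝ → ℝ) (u r : ℝ) : ℝ := -((β * q u - r) ^ 2 / q u ^ 2)

def new2Q (β : ℝ) (q C₁ : ℝ → ℝ) (u r : ℝ) : ℝ :=
  C₁ u / r - β * q u ^ 2 / 2 + q u / 2 * r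

end RobinsonTrautman

end

open scoped ContDiff
open Filter Topology

noncomputable section

namespace RobinsonTrautman

/-! ### Partial derivatives -/

/-! All five models share one homogeneity. With z = r/q they read Q = C₁/r + q² f(z) and F = -2
e(z)² with e > 0, so a model is just a pair of one-variable functions f, e and a constant c such
that z² 𝓛_F e = c and (z f)' = z² 𝓛/2 + 2 c e. `solvesExactly_of_homogeneous` proves the equivalence
from these two identities alone; each model then only has to check them.

Geometry: put W = ln P, k = ΔW and V = -2M/r - (Λ/3) r² + q² f(r/q); the C₁/r in Q turns m into M =
m - C₁/2. For the metric function k - 2 r W_u + V, the Einstein tensor has only three independent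
entries (`einstein_warpedMetric`): a radial one and an angular one, built from r-derivatives of V,
and the entry G^r_u, built from Δk and W_u (r V_r - 2V) + V_u. Since q² f(r/q) is homogeneous of
degree 2 in (r, q), Euler's identity gives its contribution to the last expression the factor q_u -
q W_u; the -2M/r part completes Δk to the Robinson-Trautman expression, and the Λ part drops out
(`einstein_metric`).

Matter: √(-g) 𝓛_F E equals ± c q²/P², which has no r in it, so the Maxwell equations say exactly
that q/P does not depend on u, i.e. q_u = q W_u (`maxwell_iff`). Once this holds, G^r_u = 0 is the
Robinson-Trautman equation. The radial Einstein equation is the ODE for f, and the angular one is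
its r-derivative (`angular_of_radial`), so neither constrains P, m or q further.

Born-Infeld constraint: the same Euler computation turns it into a relation between 1/r and a
function of z that is not a multiple of 1/z. Both coefficients must therefore vanish: q_u = q W_u
and C₁_u = 3 C₁ W_u. Hence C₁ is a constant times q³, which is precisely what the free constant κ
can absorb. -/

theorem hasDerivAt_pd {f : (Fin 4 → ℝ) → ℝ} {p : Fin 4 → ℝ} (hf : DifferentiableAt ℝ f p)
    (i : Fin 4) : HasDerivAt (fun t => f (Function.update p i t)) (pd i f p) (p i) := by
  have h1 : HasFDerivAt f (fderiv ℝ f p) (Function.update p i (p i)) := by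
    rw [Function.update_eq_self]; exact hf.hasFDerivAt
  exact (h1.comp_hasDerivAt (p i) (hasDerivAt_update p i (p i))).differentiableAt.hasDerivAt

theorem pd_eq_fderiv {f : (Fin 4 → ℝ) → ℝ} {p : Fin 4 → ℝ} (hf : DifferentiableAt ℝ f p)
    (i : Fin 4) : pd i f p = fderiv ℝ f p (Pi.single i 1) := by
  have h1 : HasFDerivAt f (fderiv ℝ f p) (Function.update p i (p i)) := by
    rw [Function.update_eq_self]; exact hf.hasFDerivAt
  exact (h1.comp_hasDerivAt (p i) (hasDerivAt_update p i (p i))).deriv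

theorem pd_congr {f g : (Fin 4 → ℝ) → ℝ} {p : Fin 4 → ℝ} (h : f =ᶠ[𝓝 p] g) (i : Fin 4) :
    pd i f p = pd i g p := by
  refine EventuallyEq.deriv_eq ?_
  have hc : Tendsto (fun t => Function.update p i t) (𝓝 (p i)) (𝓝 p) := by
    have h1 : ContinuousAt (fun t => Function.update p i t) (p i) :=
      (hasDerivAt_update p i (p i)).continuousAt
    have h2 := h1.tendsto
    rwa [Function.update_eq_self] at h2
  exact hc.eventually h

theorem pd_congr_of_isOpen {D : Set (Fin 4 → ℝ)} (hD : IsOpen D) {f g : (Fin 4 → ℝ) → ℝ}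
    (h : ∀ p ∈ D, f p = g p) {p : Fin 4 → ℝ} (hp : p ∈ D) (i : Fin 4) : pd i f p = pd i g p :=
  pd_congr (eventually_of_mem (hD.mem_nhds hp) h) i

theorem pd_const (i : Fin 4) (c : ℝ) (p : Fin 4 → ℝ) : pd i (fun _ => c) p = 0 := by
  simp [pd]

theorem pd_coord (i j : Fin 4) (p : Fin 4 → ℝ) :
    pd i (fun z => z j) p = if i = j then 1 else 0 := by
  by_cases h : i = j
  · subst h; simp [pd]
  · simp [pd, h, Function.update_of_ne (Ne.symm h)]

section rules

variable {f g : (Fin 4 → ℝ) → ℝ} {p : Fin 4 → ℝ}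

theorem pd_neg (i : Fin 4) : pd i (fun z => -f z) p = -pd i f p := by
  simp [pd]

theorem pd_add (hf : DifferentiableAt ℝ f p) (hg : DifferentiableAt ℝ g p) (i : Fin 4) :
    pd i (fun z => f z + g z) p = pd i f p + pd i g p :=
  ((hasDerivAt_pd hf i).add (hasDerivAt_pd hg i)).deriv

theorem pd_sub (hf : DifferentiableAt ℝ f p) (hg : DifferentiableAt ℝ g p) (i : Fin 4) :
    pd i (fun z => f z - g z) p = pd i f p - pd i g p :=
  ((hasDerivAt_pd hf i).sub (hasDerivAt_pd hg i)).deriv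

theorem pd_mul (hf : DifferentiableAt ℝ f p) (hg : DifferentiableAt ℝ g p) (i : Fin 4) :
    pd i (fun z => f z * g z) p = pd i f p * g p + f p * pd i g p := by
  have h := ((hasDerivAt_pd hf i).mul (hasDerivAt_pd hg i)).deriv
  rw [Function.update_eq_self] at h
  exact h

theorem pd_div (hf : DifferentiableAt ℝ f p) (hg : DifferentiableAt ℝ g p) (h0 : g p ≠ 0)
    (i : Fin 4) :
    pd i (fun z => f z / g z) p = (pd i f p * g p - f p * pd i g p) / g p ^ 2 := by
  have h := ((hasDerivAt_pd hf i).div (hasDerivAt_pd hg i)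
    (by rwa [Function.update_eq_self])).deriv
  rw [Function.update_eq_self] at h
  exact h

theorem pd_div_const (c : ℝ) (i : Fin 4) :
    pd i (fun z => f z / c) p = pd i f p / c := by
  simp [pd]

theorem pd_const_mul (c : ℝ) (i : Fin 4) :
    pd i (fun z => c * f z) p = c * pd i f p := by
  simp [pd]

theorem pd_pow (hf : DifferentiableAt ℝ f p) (n : ℕ) (i : Fin 4) :
    pd i (fun z => f z ^ n) p = n * f p ^ (n - 1) * pd i f p := by
  have h := ((hasDerivAt_pd hf i).pow n).deriv
  rw [Function.update_eq_self] at h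
  exact h

theorem pd_exp (hf : DifferentiableAt ℝ f p) (i : Fin 4) :
    pd i (fun z => Real.exp (f z)) p = Real.exp (f p) * pd i f p := by
  have h := ((hasDerivAt_pd hf i).exp).deriv
  rw [Function.update_eq_self] at h
  exact h

end rules

/-! ### Smooth functions: closure under `pd` and symmetry of second derivatives -/

section smooth

variable {D : Set (Fin 4 → ℝ)} {f : (Fin 4 → ℝ) → ℝ}

theorem differentiableAt_of_contDiffOn (hD : IsOpen D) (hf : ContDiffOn ℝ ∞ f D)
    {p : Fin 4 → ℝ} (hp : p ∈ D) : DifferentiableAt ℝ f p :=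
  (hf.contDiffAt (hD.mem_nhds hp)).differentiableAt (by simp)

theorem contDiffOn_pd (hD : IsOpen D) (hf : ContDiffOn ℝ ∞ f D) (i : Fin 4) :
    ContDiffOn ℝ ∞ (pd i f) D := by
  have h1 : ContDiffOn ℝ ∞ (fun p => fderiv ℝ f p (Pi.single i 1)) D :=
    (hf.fderiv_of_isOpen hD (by simp)).clm_apply contDiffOn_const
  exact h1.congr fun p hp => pd_eq_fderiv (differentiableAt_of_contDiffOn hD hf hp) i

theorem pd_comm (hD : IsOpen D) (hf : ContDiffOn ℝ ∞ f D) (i j : Fin 4)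
    {p : Fin 4 → ℝ} (hp : p ∈ D) : pd i (pd j f) p = pd j (pd i f) p := by
  have hf' : DifferentiableAt ℝ (fderiv ℝ f) p :=
    ((hf.fderiv_of_isOpen (m := ∞) hD (by simp)).contDiffAt (hD.mem_nhds hp)).differentiableAt
      (by simp)
  have key : ∀ i j : Fin 4, pd i (pd j f) p
      = fderiv ℝ (fderiv ℝ f) p (Pi.single i 1) (Pi.single j 1) := by
    intro i j
    rw [pd_congr_of_isOpen hD
      (fun z hz => pd_eq_fderiv (differentiableAt_of_contDiffOn hD hf hz) j) hp i,
      pd_eq_fderiv (hf'.clm_apply (differentiableAt_const _)),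
      fderiv_clm_apply hf' (differentiableAt_const _)]
    simp
  rw [key, key]
  exact ((hf.contDiffAt (hD.mem_nhds hp)).isSymmSndFDerivAt
    (by simpa using WithTop.coe_le_coe.2 (le_top (a := (2 : ℕ∞))))).eq _ _

end smooth

/-! ### Curvature of the Robinson-Trautman form -/

/-- The function `r² / P²` in terms of `W = ln P`. -/
def areaFactor (W : (Fin 4 → ℝ) → ℝ) (p : Fin 4 → ℝ) : ℝ := p 1 ^ 2 * Real.exp (-2 * W p)

/-- The metric `-K du² - 2 du dr + r² e^{-2W} (dx² + dy²)`. -/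
def warpedMetric (K W : (Fin 4 → ℝ) → ℝ) : TensorField := fun p =>
  !![-K p, -1, 0, 0;
     -1, 0, 0, 0;
     0, 0, areaFactor W p, 0;
     0, 0, 0, areaFactor W p]

/-- The Christoffel symbols `Γ^a_{bc}` of `warpedMetric K W` when `W` does not depend on `r`. -/
def warpedChristoffel (K W : (Fin 4 → ℝ) → ℝ) (a b c : Fin 4) : (Fin 4 → ℝ) → ℝ :=
  ![!![fun p => -pd 1 K p / 2, fun _ => 0, fun _ => 0, fun _ => 0;
       fun _ => 0, fun _ => 0, fun _ => 0, fun _ => 0;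
       fun _ => 0, fun _ => 0, fun p => areaFactor W p / p 1, fun _ => 0;
       fun _ => 0, fun _ => 0, fun _ => 0, fun p => areaFactor W p / p 1],
    !![fun p => (pd 0 K p + K p * pd 1 K p) / 2, fun p => pd 1 K p / 2,
         fun p => pd 2 K p / 2, fun p => pd 3 K p / 2;
       fun p => pd 1 K p / 2, fun _ => 0, fun _ => 0, fun _ => 0;
       fun p => pd 2 K p / 2, fun _ => 0,
         fun p => -(areaFactor W p * (pd 0 W p + K p / p 1)), fun _ => 0;
       fun p => pd 3 K p / 2, fun _ => 0, fun _ => 0,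
         fun p => -(areaFactor W p * (pd 0 W p + K p / p 1))],
    !![fun p => pd 2 K p / (2 * areaFactor W p), fun _ => 0, fun p => -pd 0 W p, fun _ => 0;
       fun _ => 0, fun _ => 0, fun p => 1 / p 1, fun _ => 0;
       fun p => -pd 0 W p, fun p => 1 / p 1, fun p => -pd 2 W p, fun p => -pd 3 W p;
       fun _ => 0, fun _ => 0, fun p => -pd 3 W p, fun p => pd 2 W p],
    !![fun p => pd 3 K p / (2 * areaFactor W p), fun _ => 0, fun _ => 0, fun p => -pd 0 W p;
       fun _ => 0, fun _ => 0, fun _ => 0, fun p => 1 / p 1;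
       fun _ => 0, fun _ => 0, fun p => pd 3 W p, fun p => -pd 2 W p;
       fun p => -pd 0 W p, fun p => 1 / p 1, fun p => -pd 2 W p, fun p => -pd 3 W p]] a b c

theorem areaFactor_pos (W : (Fin 4 → ℝ) → ℝ) {p : Fin 4 → ℝ} (hr : 0 < p 1) :
    0 < areaFactor W p := by
  unfold areaFactor; positivity

theorem warpedMetric_inv (K W : (Fin 4 → ℝ) → ℝ) {p : Fin 4 → ℝ} (hr : 0 < p 1) :
    (warpedMetric K W p)⁻¹ =
      !![0, -1, 0, 0;
         -1, K p, 0, 0;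
         0, 0, 1 / areaFactor W p, 0;
         0, 0, 0, 1 / areaFactor W p] := by
  have h := (areaFactor_pos W hr).ne'
  refine Matrix.inv_eq_right_inv ?_
  ext i j
  fin_cases i <;> fin_cases j <;>
    simp [warpedMetric, Matrix.mul_apply, Fin.sum_univ_four, h]

theorem warpedMetric_det (K W : (Fin 4 → ℝ) → ℝ) (p : Fin 4 → ℝ) :
    (warpedMetric K W p).det = -areaFactor W p ^ 2 := by
  simp [warpedMetric, Matrix.det_succ_row_zero, Fin.sum_univ_succ, Fin.succAbove]
  ring

section curvature

variable {D : Set (Fin 4 → ℝ)} {K W : (Fin 4 → ℝ) → ℝ} {p : Fin 4 → ℝ}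

theorem contDiffOn_areaFactor (hW : ContDiffOn ℝ ∞ W D) : ContDiffOn ℝ ∞ (areaFactor W) D := by
  unfold areaFactor
  exact ((contDiff_apply ℝ ℝ 1).contDiffOn.pow 2).mul ((contDiffOn_const.mul hW).exp)

theorem pd_areaFactor (hW : DifferentiableAt ℝ W p) (hr : 0 < p 1) (i : Fin 4) :
    pd i (areaFactor W) p
      = 2 * areaFactor W p * ((if i = 1 then 1 / p 1 else 0) - pd i W p) := by
  have h1 : DifferentiableAt ℝ (fun z : Fin 4 → ℝ => z 1) p := differentiableAt_apply 1 p
  have h2 : DifferentiableAt ℝ (fun z => -2 * W z) p := hW.const_mul _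
  have h3 : DifferentiableAt ℝ (fun z : Fin 4 → ℝ => z 1 ^ 2) p := h1.pow 2
  unfold areaFactor
  rw [pd_mul h3 h2.exp, pd_pow h1, pd_exp h2, pd_const_mul, pd_coord]
  split_ifs <;> field_simp <;> ring

theorem christoffel_warpedMetric (hD : IsOpen D) (hr : ∀ z ∈ D, 0 < z 1)
    (hW : ContDiffOn ℝ ∞ W D) (hW1 : ∀ z ∈ D, pd 1 W z = 0) (hp : p ∈ D) (a b c : Fin 4) :
    christoffel (warpedMetric K W) a b c p = warpedChristoffel K W a b c p := by
  have hr' := hr p hp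
  have hA := (areaFactor_pos W hr').ne'
  have hdW := differentiableAt_of_contDiffOn hD hW hp
  have hg : ∀ i a b : Fin 4, pd i (fun z => warpedMetric K W z a b) p =
      !![-pd i K p, 0, 0, 0;
         0, 0, 0, 0;
         0, 0, pd i (areaFactor W) p, 0;
         0, 0, 0, pd i (areaFactor W) p] a b := by
    intro i a b
    fin_cases a <;> fin_cases b <;>
      simp [warpedMetric, pd_neg, pd_const]
  have h1 := hW1 p hp
  simp only [christoffel, hg, warpedMetric_inv K W hr', Fin.sum_univ_four,
    pd_areaFactor hdW hr', warpedChristoffel]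
  fin_cases a <;> fin_cases b <;> fin_cases c <;>
    simp [h1] <;> field_simp <;> ring

end curvature

section curvature

variable {D : Set (Fin 4 → ℝ)} {K W : (Fin 4 → ℝ) → ℝ} {p : Fin 4 → ℝ}

/-- The explicit symbols are differentiated entry by entry. The bound names A, d, s stand for the
area factor, ∂_j r, and ∂_j of (area factor)/r. -/
theorem pd_warpedChristoffel (hD : IsOpen D) (hr : ∀ z ∈ D, 0 < z 1) (hK : ContDiffOn ℝ ∞ K D)
    (hW : ContDiffOn ℝ ∞ W D) (hp : p ∈ D) (j a b c : Fin 4) :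
    pd j (warpedChristoffel K W a b c) p =
      (fun A d s : ℝ =>
      ![!![-pd j (pd 1 K) p / 2, 0, 0, 0;
           0, 0, 0, 0;
           0, 0, s, 0;
           0, 0, 0, s],
        !![(pd j (pd 0 K) p + pd j K p * pd 1 K p + K p * pd j (pd 1 K) p) / 2,
             pd j (pd 1 K) p / 2, pd j (pd 2 K) p / 2, pd j (pd 3 K) p / 2;
           pd j (pd 1 K) p / 2, 0, 0, 0;
           pd j (pd 2 K) p / 2, 0,
             -(2 * A * (d / p 1 - pd j W p) * (pd 0 W p + K p / p 1)
               + A * (pd j (pd 0 W) p + pd j K p / p 1 - K p * d / p 1 ^ 2)), 0;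
           pd j (pd 3 K) p / 2, 0, 0,
             -(2 * A * (d / p 1 - pd j W p) * (pd 0 W p + K p / p 1)
               + A * (pd j (pd 0 W) p + pd j K p / p 1 - K p * d / p 1 ^ 2))],
        !![pd j (pd 2 K) p / (2 * A) - pd 2 K p / A * (d / p 1 - pd j W p), 0,
             -pd j (pd 0 W) p, 0;
           0, 0, -d / p 1 ^ 2, 0;
           -pd j (pd 0 W) p, -d / p 1 ^ 2, -pd j (pd 2 W) p, -pd j (pd 3 W) p;
           0, 0, -pd j (pd 3 W) p, pd j (pd 2 W) p],
        !![pd j (pd 3 K) p / (2 * A) - pd 3 K p / A * (d / p 1 - pd j W p), 0, 0,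
             -pd j (pd 0 W) p;
           0, 0, 0, -d / p 1 ^ 2;
           0, 0, pd j (pd 3 W) p, -pd j (pd 2 W) p;
           -pd j (pd 0 W) p, -d / p 1 ^ 2, -pd j (pd 2 W) p, -pd j (pd 3 W) p]] a b c)
      (areaFactor W p) (if j = 1 then 1 else 0)
      (2 * areaFactor W p * ((if j = 1 then 1 else 0) / p 1 - pd j W p) / p 1
        - areaFactor W p * (if j = 1 then 1 else 0) / p 1 ^ 2) := by
  have hr' := hr p hp
  have hA := (areaFactor_pos W hr').ne'
  have hdr : DifferentiableAt ℝ (fun z : Fin 4 → ℝ => z 1) p := differentiableAt_apply 1 p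
  have hdK := differentiableAt_of_contDiffOn hD hK hp
  have hdW := differentiableAt_of_contDiffOn hD hW hp
  have hdA := differentiableAt_of_contDiffOn hD (contDiffOn_areaFactor hW) hp
  have hdKi := fun i => differentiableAt_of_contDiffOn hD (contDiffOn_pd hD hK i) hp
  have hdWi := fun i => differentiableAt_of_contDiffOn hD (contDiffOn_pd hD hW i) hp
  have hAj := pd_areaFactor hdW hr' j
  have e1 : pd j (fun z => areaFactor W z / z 1) p
      = 2 * areaFactor W p * ((if j = 1 then 1 else 0) / p 1 - pd j W p) / p 1
        - areaFactor W p * (if j = 1 then 1 else 0) / p 1 ^ 2 := by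
    rw [pd_div hdA hdr hr'.ne', pd_coord, hAj]
    split_ifs <;> field_simp <;> ring
  have e2 : pd j (fun z => (pd 0 K z + K z * pd 1 K z) / 2) p
      = (pd j (pd 0 K) p + pd j K p * pd 1 K p + K p * pd j (pd 1 K) p) / 2 := by
    rw [pd_div_const, pd_add (hdKi 0) (hdK.fun_mul (hdKi 1)), pd_mul hdK (hdKi 1), add_assoc]
  have hKr : DifferentiableAt ℝ (fun z => K z / z 1) p :=  by
    fun_prop (disch := exact hr'.ne')
  have hWK : DifferentiableAt ℝ (fun z => pd 0 W z + K z / z 1) p := (hdWi 0).add hKr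
  have e3 : pd j (fun z => -(areaFactor W z * (pd 0 W z + K z / z 1))) p
      = -(2 * areaFactor W p * ((if j = 1 then 1 else 0) / p 1 - pd j W p)
            * (pd 0 W p + K p / p 1)
          + areaFactor W p * (pd j (pd 0 W) p + pd j K p / p 1
            - K p * (if j = 1 then 1 else 0) / p 1 ^ 2)) := by
    rw [pd_neg, pd_mul hdA hWK, pd_add (hdWi 0) hKr, pd_div hdK hdr hr'.ne', pd_coord, hAj]
    split_ifs <;> field_simp <;> ring
  have e4 : ∀ i, pd j (fun z => pd i K z / (2 * areaFactor W z)) p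
      = pd j (pd i K) p / (2 * areaFactor W p)
        - pd i K p / areaFactor W p * ((if j = 1 then 1 else 0) / p 1 - pd j W p) := by
    intro i
    rw [pd_div (hdKi i) (hdA.const_mul 2) (by positivity), pd_const_mul, hAj]
    split_ifs <;> field_simp <;> ring
  have e5 : pd j (fun z => 1 / z 1) p = -(if j = 1 then 1 else 0) / p 1 ^ 2 := by
    rw [pd_div (differentiableAt_const _) hdr hr'.ne', pd_coord, pd_const]
    split_ifs <;> simp
  have e6 : ∀ i, pd j (fun z => -pd i W z) p = -pd j (pd i W) p := fun i => pd_neg j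
  have e7 : ∀ i, pd j (fun z => pd i K z / 2) p = pd j (pd i K) p / 2 := fun i => pd_div_const 2 j
  have e8 : pd j (fun z => -pd 1 K z / 2) p = -pd j (pd 1 K) p / 2 := by
    rw [pd_div_const, pd_neg]
  have e9 : pd j (fun _ => 0) p = 0 := pd_const _ _ _
  fin_cases a <;> fin_cases b <;> fin_cases c <;>
    first
      | exact e9 | exact e1 | exact e2 | exact e3 | exact e4 _ | exact e5 | exact e6 _
      | exact e7 _ | exact e8 | rfl

end curvature

section curvature

variable {D : Set (Fin 4 → ℝ)} {K W : (Fin 4 → ℝ) → ℝ} {p : Fin 4 → ℝ}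

/-- Since the symbols have a closed form on an open set, their derivatives do too, and the
contraction is a finite computation. It uses W_r = 0 together with its consequence that every second
derivative of W involving r vanishes. -/
theorem ricci_warpedMetric (hD : IsOpen D) (hr : ∀ z ∈ D, 0 < z 1) (hK : ContDiffOn ℝ ∞ K D)
    (hW : ContDiffOn ℝ ∞ W D) (hW1 : ∀ z ∈ D, pd 1 W z = 0) (hp : p ∈ D) (b c : Fin 4) :
    ricci (warpedMetric K W) b c p =
      (fun R₀₀ R₀₁ R₀₂ R₀₃ R₂₂ =>
      !![R₀₀, R₀₁, R₀₂, R₀₃;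
         R₀₁, 0, 0, 0;
         R₀₂, 0, R₂₂, 0;
         R₀₃, 0, 0, R₂₂] b c)
      (K p * pd 1 (pd 1 K) p / 2
        + (pd 2 (pd 2 K) p + pd 3 (pd 3 K) p) / (2 * areaFactor W p) + 2 * pd 0 (pd 0 W) p
        - 2 * pd 0 W p ^ 2 + pd 0 W p * pd 1 K p + pd 0 K p / p 1 + K p * pd 1 K p / p 1)
      (pd 1 (pd 1 K) p / 2 + pd 1 K p / p 1 + 2 * pd 0 W p / p 1)
      (pd 1 (pd 2 K) p / 2 + pd 2 (pd 0 W) p)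
      (pd 1 (pd 3 K) p / 2 + pd 3 (pd 0 W) p)
      (pd 2 (pd 2 W) p + pd 3 (pd 3 W) p
        - areaFactor W p * (pd 1 K p / p 1 + 4 * pd 0 W p / p 1 + K p / p 1 ^ 2)) := by
  have hr' := hr p hp
  have hA := (areaFactor_pos W hr').ne'
  have h1 := hW1 p hp
  have h1i : ∀ i, pd i (pd 1 W) p = 0 := fun i => by
    rw [pd_congr_of_isOpen hD hW1 hp, pd_const]
  have hi1 : ∀ i, pd 1 (pd i W) p = 0 := fun i => by rw [pd_comm hD hW 1 i hp, h1i]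
  have hG := fun i a b c : Fin 4 =>
    (pd_congr_of_isOpen hD (fun z hz => christoffel_warpedMetric hD hr hW hW1 hz a b c) hp i).trans
      (pd_warpedChristoffel hD hr hK hW hp i a b c)
  -- Each mixed second derivative is brought to a single order, so that `ring` sees equal atoms.
  have k10 := pd_comm hD hK 1 0 hp
  have k20 := pd_comm hD hK 2 0 hp
  have k30 := pd_comm hD hK 3 0 hp
  have k21 := pd_comm hD hK 2 1 hp
  have k31 := pd_comm hD hK 3 1 hp
  have k32 := pd_comm hD hK 3 2 hp
  have w20 := pd_comm hD hW 0 2 hp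
  have w30 := pd_comm hD hW 0 3 hp
  have w32 := pd_comm hD hW 3 2 hp
  simp only [ricci, hG, christoffel_warpedMetric hD hr hW hW1 hp, Fin.sum_univ_four, warpedChristoffel]
  fin_cases b <;> fin_cases c <;>
    simp [h1, hi1, k10, k20, k30, k21, k31, k32, w20, w30, w32] <;> field_simp <;> ring

end curvature

/-! ### Locality of curvature: it depends only on the metric on an open set -/

section congruence

variable {D : Set (Fin 4 → ℝ)} {g g' : TensorField} {p : Fin 4 → ℝ}

theorem christoffel_congr (hD : IsOpen D) (h : ∀ z ∈ D, g z = g' z) (hp : p ∈ D)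
    (a b c : Fin 4) : christoffel g a b c p = christoffel g' a b c p := by
  have h' : ∀ i a b : Fin 4, pd i (fun z => g z a b) p = pd i (fun z => g' z a b) p :=
    fun i a b => pd_congr_of_isOpen hD (fun z hz => by rw [h z hz]) hp i
  simp only [christoffel, h', h p hp]

theorem ricci_congr (hD : IsOpen D) (h : ∀ z ∈ D, g z = g' z) (hp : p ∈ D)
    (b c : Fin 4) : ricci g b c p = ricci g' b c p := by
  have h' : ∀ i a b c : Fin 4, pd i (christoffel g a b c) p = pd i (christoffel g' a b c) p :=
    fun i a b c => pd_congr_of_isOpen hD (fun z hz => christoffel_congr hD h hz a b c) hp i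
  simp only [ricci, h', christoffel_congr hD h hp]

theorem einstein_congr (hD : IsOpen D) (h : ∀ z ∈ D, g z = g' z) (hp : p ∈ D)
    (μ ν : Fin 4) : einstein g μ ν p = einstein g' μ ν p := by
  simp only [einstein, scalarCurvature, ricciMixed, ricci_congr hD h hp, h p hp]

end congruence

section curvature

variable {D : Set (Fin 4 → ℝ)} {W k V : (Fin 4 → ℝ) → ℝ} {p : Fin 4 → ℝ}

/-- The Einstein tensor when `K = k - 2 r W_{,u} + V(u, r)` and `k = Δ W` is the curvature of the
transverse surfaces. -/
theorem einstein_warpedMetric (hD : IsOpen D) (hr : ∀ z ∈ D, 0 < z 1)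
    (hW : ContDiffOn ℝ ∞ W D) (hW1 : ∀ z ∈ D, pd 1 W z = 0)
    (hk : ContDiffOn ℝ ∞ k D) (hk1 : ∀ z ∈ D, pd 1 k z = 0)
    (hV : ContDiffOn ℝ ∞ V D) (hV2 : ∀ z ∈ D, pd 2 V z = 0) (hV3 : ∀ z ∈ D, pd 3 V z = 0)
    (hkW : ∀ z ∈ D, k z = Real.exp (2 * W z) * (pd 2 (pd 2 W) z + pd 3 (pd 3 W) z))
    (hp : p ∈ D) (μ ν : Fin 4) :
    einstein (warpedMetric (fun z => k z - 2 * z 1 * pd 0 W z + V z) W) μ ν p =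
      (fun X N Y => !![X, 0, 0, 0; -N, X, 0, 0; 0, 0, Y, 0; 0, 0, 0, Y] μ ν)
      (pd 1 V p / p 1 + V p / p 1 ^ 2)
      (Real.exp (2 * W p) * (pd 2 (pd 2 k) p + pd 3 (pd 3 k) p) / (2 * p 1 ^ 2)
        + (pd 0 W p * (p 1 * pd 1 V p - 2 * V p) + pd 0 V p) / p 1)
      (pd 1 (pd 1 V) p / 2 + pd 1 V p / p 1) := by
  have hr' := hr p hp
  have hA := (areaFactor_pos W hr').ne'
  have hW0 := contDiffOn_pd hD hW 0
  have hc : ContDiffOn ℝ ∞ (fun z : Fin 4 → ℝ => 2 * z 1) D :=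
    contDiffOn_const.mul (contDiff_apply ℝ ℝ 1).contDiffOn
  have hK : ContDiffOn ℝ ∞ (fun z => k z - 2 * z 1 * pd 0 W z + V z) D :=
    (hk.sub (hc.mul hW0)).add hV
  have hd := fun {f : (Fin 4 → ℝ) → ℝ} (hf : ContDiffOn ℝ ∞ f D) {z : Fin 4 → ℝ} (hz : z ∈ D) =>
    differentiableAt_of_contDiffOn hD hf hz
  have hKi : ∀ i, ∀ z ∈ D, pd i (fun z => k z - 2 * z 1 * pd 0 W z + V z) z
      = pd i k z - (2 * (if i = 1 then 1 else 0) * pd 0 W z + 2 * z 1 * pd i (pd 0 W) z)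
        + pd i V z := by
    intro i z hz
    rw [pd_add (hd (hk.sub (hc.mul hW0)) hz) (hd hV hz),
      pd_sub (hd hk hz) (hd (hc.mul hW0) hz), pd_mul (hd hc hz) (hd hW0 hz), pd_const_mul,
      pd_coord]
  have h01 : ∀ z ∈ D, pd 1 (pd 0 W) z = 0 := fun z hz => by
    rw [pd_comm hD hW 1 0 hz, pd_congr_of_isOpen hD hW1 hz, pd_const]
  have hK1 : ∀ z ∈ D, pd 1 (fun z => k z - 2 * z 1 * pd 0 W z + V z) z
      = -2 * pd 0 W z + pd 1 V z := fun z hz => by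
    rw [hKi 1 z hz, h01 z hz, hk1 z hz]; simp
  have hK2 : ∀ z ∈ D, pd 2 (fun z => k z - 2 * z 1 * pd 0 W z + V z) z
      = pd 2 k z - 2 * z 1 * pd 2 (pd 0 W) z := fun z hz => by
    rw [hKi 2 z hz, hV2 z hz]; simp
  have hK3 : ∀ z ∈ D, pd 3 (fun z => k z - 2 * z 1 * pd 0 W z + V z) z
      = pd 3 k z - 2 * z 1 * pd 3 (pd 0 W) z := fun z hz => by
    rw [hKi 3 z hz, hV3 z hz]; simp
  have hK0 : pd 0 (fun z => k z - 2 * z 1 * pd 0 W z + V z) p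
      = pd 0 k p - 2 * p 1 * pd 0 (pd 0 W) p + pd 0 V p := by
    rw [hKi 0 p hp]; simp
  have hW0' : ContDiffOn ℝ ∞ (fun z => -2 * pd 0 W z) D := contDiffOn_const.mul hW0
  have hV1 := contDiffOn_pd hD hV 1
  have hKi1 : ∀ i, pd i (pd 1 (fun z => k z - 2 * z 1 * pd 0 W z + V z)) p
      = -2 * pd i (pd 0 W) p + pd i (pd 1 V) p := fun i => by
    rw [pd_congr_of_isOpen hD hK1 hp, pd_add (hd hW0' hp) (hd hV1 hp), pd_const_mul]
  have hVi1 : ∀ i, (∀ z ∈ D, pd i V z = 0) → pd i (pd 1 V) p = 0 := fun i h => by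
    rw [pd_comm hD hV i 1 hp, pd_congr_of_isOpen hD h hp, pd_const]
  have hK11 : pd 1 (pd 1 (fun z => k z - 2 * z 1 * pd 0 W z + V z)) p = pd 1 (pd 1 V) p := by
    rw [hKi1, h01 p hp]; ring
  -- The term -2 r W_u in K is chosen for this: K_rx/2 + W_xu, which is R_ux, vanishes. The same
  -- happens for y.
  have hK12 : pd 1 (pd 2 (fun z => k z - 2 * z 1 * pd 0 W z + V z)) p
      = -2 * pd 2 (pd 0 W) p := by
    rw [pd_comm hD hK 1 2 hp, hKi1, hVi1 2 hV2]; ring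
  have hK13 : pd 1 (pd 3 (fun z => k z - 2 * z 1 * pd 0 W z + V z)) p
      = -2 * pd 3 (pd 0 W) p := by
    rw [pd_comm hD hK 1 3 hp, hKi1, hVi1 3 hV3]; ring
  have hsub : ∀ i, i ≠ 1 → pd i (fun z => pd i k z - 2 * z 1 * pd i (pd 0 W) z) p
      = pd i (pd i k) p - 2 * p 1 * pd i (pd i (pd 0 W)) p := fun i hi => by
    have h1 := contDiffOn_pd hD hW0 i
    rw [pd_sub (hd (contDiffOn_pd hD hk i) hp) (hd (hc.mul h1) hp), pd_mul (hd hc hp) (hd h1 hp),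
      pd_const_mul, pd_coord]
    simp [hi]
  have hK22 : pd 2 (pd 2 (fun z => k z - 2 * z 1 * pd 0 W z + V z)) p
      = pd 2 (pd 2 k) p - 2 * p 1 * pd 2 (pd 2 (pd 0 W)) p := by
    rw [pd_congr_of_isOpen hD hK2 hp, hsub 2 (by decide)]
  have hK33 : pd 3 (pd 3 (fun z => k z - 2 * z 1 * pd 0 W z + V z)) p
      = pd 3 (pd 3 k) p - 2 * p 1 * pd 3 (pd 3 (pd 0 W)) p := by
    rw [pd_congr_of_isOpen hD hK3 hp, hsub 3 (by decide)]
  have hcomm : ∀ i, pd 0 (pd i (pd i W)) p = pd i (pd i (pd 0 W)) p := fun i => by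
    rw [pd_comm hD (contDiffOn_pd hD hW i) 0 i hp,
      pd_congr_of_isOpen hD (fun z hz => pd_comm hD hW 0 i hz) hp]
  have hW22 := contDiffOn_pd hD (contDiffOn_pd hD hW 2) 2
  have hW33 := contDiffOn_pd hD (contDiffOn_pd hD hW 3) 3
  have h2W : ContDiffOn ℝ ∞ (fun z => 2 * W z) D := contDiffOn_const.mul hW
  -- Differentiating k = e^{2W}(W_xx + W_yy) in u gives third derivatives of W, which cancel those
  -- coming from the second x- and y-derivatives of -2 r W_u.
  have hk0 : pd 0 k p = 2 * pd 0 W p * k p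
      + Real.exp (2 * W p) * (pd 2 (pd 2 (pd 0 W)) p + pd 3 (pd 3 (pd 0 W)) p) := by
    rw [pd_congr_of_isOpen hD hkW hp, pd_mul (hd h2W.exp hp) (hd (hW22.add hW33) hp),
      pd_exp (hd h2W hp), pd_const_mul, pd_add (hd hW22 hp) (hd hW33 hp), hcomm, hcomm, hkW p hp]
    ring
  have hE : areaFactor W p = p 1 ^ 2 / Real.exp (2 * W p) := by
    rw [areaFactor, neg_mul, Real.exp_neg]; rfl
  -- Solving the relation between k and W for W_xx makes it a rewrite rule; with the exponential
  -- generalized, only rational identities remain.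
  have hkE : pd 2 (pd 2 W) p = k p / Real.exp (2 * W p) - pd 3 (pd 3 W) p := by
    rw [hkW p hp]; field_simp; ring
  have hexp := Real.exp_ne_zero (2 * W p)
  simp only [einstein, scalarCurvature, ricciMixed, ricci_warpedMetric hD hr hK hW hW1 hp,
    warpedMetric_inv _ W hr', Fin.sum_univ_four, hK0, hK1 p hp, hK11, hK12, hK13, hK22, hK33,
    hk0, hE, delta, hkE]
  clear hk0 hkE hE hK0 hK1 hK11 hK12 hK13 hK22 hK33 hsub hKi hKi1 hcomm hkW hK hd
  generalize Real.exp (2 * W p) = e at *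
  fin_cases μ <;> fin_cases ν <;> simp <;> field_simp <;>
    first | ring1 | simp

end curvature

/-! ### Electrodynamics -/

section electrodynamics

variable {K W : (Fin 4 → ℝ) → ℝ} {g : TensorField} {p : Fin 4 → ℝ}

theorem raised_faraday (E : ℝ → ℝ → ℝ) (hg : g p = warpedMetric K W p) (hr : 0 < p 1)
    (μ ν : Fin 4) :
    raised g (faraday E) μ ν p =
      !![0, -E (p 0) (p 1), 0, 0; E (p 0) (p 1), 0, 0, 0; 0, 0, 0, 0; 0, 0, 0, 0] μ ν := by
  simp only [raised, hg, warpedMetric_inv K W hr, Fin.sum_univ_four, faraday]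
  fin_cases μ <;> fin_cases ν <;> simp

theorem fieldInvariant_faraday (E : ℝ → ℝ → ℝ) (hg : g p = warpedMetric K W p) (hr : 0 < p 1) :
    fieldInvariant g (faraday E) p = -2 * E (p 0) (p 1) ^ 2 := by
  simp only [fieldInvariant, raised_faraday E hg hr, Fin.sum_univ_four, faraday]
  simp
  ring

theorem energyMomentum_faraday (L : ℝ → ℝ) (E : ℝ → ℝ → ℝ) (hg : g p = warpedMetric K W p)
    (hr : 0 < p 1) (μ ν : Fin 4) :
    energyMomentum L g (faraday E) μ ν p =
      (fun X Y => !![X, 0, 0, 0; 0, X, 0, 0; 0, 0, Y, 0; 0, 0, 0, Y] μ ν)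
      (L (-2 * E (p 0) (p 1) ^ 2) / 2
        + 2 * E (p 0) (p 1) ^ 2 * deriv L (-2 * E (p 0) (p 1) ^ 2))
      (L (-2 * E (p 0) (p 1) ^ 2) / 2) := by
  simp only [energyMomentum, fieldInvariant_faraday E hg hr, raised_faraday E hg hr,
    Fin.sum_univ_four, faraday, delta]
  fin_cases μ <;> fin_cases ν <;> simp <;> ring

/-- For distinct indices each term either differentiates E(u, r) along x or y, or differentiates a
vanishing component; for repeated indices antisymmetry cancels the sum. -/
theorem pd_faraday_cyclic (E : ℝ → ℝ → ℝ) (p : Fin 4 → ℝ) (a b c : Fin 4) :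
    pd a (fun z => faraday E z b c) p + pd b (fun z => faraday E z c a) p
      + pd c (fun z => faraday E z a b) p = 0 := by
  have h : ∀ i j : Fin 4, pd 2 (fun z => faraday E z i j) p = 0 ∧
      pd 3 (fun z => faraday E z i j) p = 0 := by
    intro i j
    fin_cases i <;> fin_cases j <;> simp [pd, faraday]
  fin_cases a <;> fin_cases b <;> fin_cases c <;> simp [h] <;>
    simp [faraday, pd_const, pd_neg]

theorem sqrt_neg_det_warpedMetric (K W : (Fin 4 → ℝ) → ℝ) (hr : 0 < p 1) :
    Real.sqrt (-(warpedMetric K W p).det) = areaFactor W p := by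
  rw [warpedMetric_det, neg_neg, Real.sqrt_sq (areaFactor_pos W hr).le]

variable {D : Set (Fin 4 → ℝ)}

theorem maxwell_faraday_iff (L : ℝ → ℝ) (E : ℝ → ℝ → ℝ) (hD : IsOpen D)
    (hr : ∀ z ∈ D, 0 < z 1) (hg : ∀ z ∈ D, g z = warpedMetric K W z) (hp : p ∈ D) :
    (∀ ν, ∑ μ, pd μ (fun z => Real.sqrt (-(g z).det)
        * deriv L (fieldInvariant g (faraday E) z) * raised g (faraday E) μ ν z) p = 0) ↔
      ∀ i : Fin 4, i = 0 ∨ i = 1 → pd i (fun z => areaFactor W z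
        * deriv L (-2 * E (z 0) (z 1) ^ 2) * E (z 0) (z 1)) p = 0 := by
  have h : ∀ μ ν : Fin 4, pd μ (fun z => Real.sqrt (-(g z).det)
        * deriv L (fieldInvariant g (faraday E) z) * raised g (faraday E) μ ν z) p
      = pd μ (fun z => areaFactor W z * deriv L (-2 * E (z 0) (z 1) ^ 2) *
        !![0, -E (z 0) (z 1), 0, 0; E (z 0) (z 1), 0, 0, 0; 0, 0, 0, 0; 0, 0, 0, 0] μ ν) p :=
    fun μ ν => pd_congr_of_isOpen hD (fun z hz => by
      rw [fieldInvariant_faraday E (hg z hz) (hr z hz), raised_faraday E (hg z hz) (hr z hz),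
        hg z hz, sqrt_neg_det_warpedMetric K W (hr z hz)]) hp μ
  simp only [h, Fin.sum_univ_four]
  constructor
  · intro H i hi
    rcases hi with rfl | rfl
    -- The only nonzero component being F^{ur}, the equation with free index r carries the
    -- u-derivative, and the one with free index u carries the r-derivative.
    · have := H 1
      simpa [pd_const, pd_neg] using this
    · have := H 0
      simpa [pd_const, pd_neg] using this
  · intro H ν
    have h0 := H 0 (Or.inl rfl)
    have h1 := H 1 (Or.inr rfl)
    simp only [neg_mul] at h0 h1
    fin_cases ν <;> simp [pd_const, pd_neg, h0, h1]

end electrodynamics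

/-! ### Functions of the coordinates -/

theorem pd_two_pd_two (φ : ℝ → ℝ → ℝ → ℝ) (p : Fin 4 → ℝ) :
    pd 2 (pd 2 (fun z => φ (z 0) (z 2) (z 3))) p
      = iteratedDeriv 2 (fun s => φ (p 0) s (p 3)) (p 2) := by
  simp [pd, iteratedDeriv_succ]

theorem pd_three_pd_three (φ : ℝ → ℝ → ℝ → ℝ) (p : Fin 4 → ℝ) :
    pd 3 (pd 3 (fun z => φ (z 0) (z 2) (z 3))) p
      = iteratedDeriv 2 (fun s => φ (p 0) (p 2) s) (p 3) := by
  simp [pd, iteratedDeriv_succ]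

theorem lap_eq_pd (P φ : ℝ → ℝ → ℝ → ℝ) (p : Fin 4 → ℝ) :
    lap P φ (p 0) (p 2) (p 3) = P (p 0) (p 2) (p 3) ^ 2 *
      (pd 2 (pd 2 (fun z => φ (z 0) (z 2) (z 3))) p
        + pd 3 (pd 3 (fun z => φ (z 0) (z 2) (z 3))) p) := by
  rw [lap, pd_two_pd_two, pd_three_pd_three]

theorem logPu_eq_pd (P : ℝ → ℝ → ℝ → ℝ) (p : Fin 4 → ℝ) :
    logPu P (p 0) (p 2) (p 3) = pd 0 (fun z => logP P (z 0) (z 2) (z 3)) p := by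
  simp [pd, logPu]

theorem isOpen_domain {B S : Set (ℝ × ℝ)} (hB : IsOpen B) (hS : IsOpen S) :
    IsOpen (domain B S) := by
  have h1 : Continuous fun p : Fin 4 → ℝ => (p 0, p 1) := by fun_prop
  have h2 : Continuous fun p : Fin 4 → ℝ => (p 2, p 3) := by fun_prop
  exact (hB.preimage h1).inter (hS.preimage h2)

theorem contDiffOn_comp_coord {u₀ : ℝ} {D : Set (Fin 4 → ℝ)} {φ : ℝ → ℝ}
    (hφ : ContDiffOn ℝ ∞ φ (Set.Ioi u₀)) (hD : ∀ p ∈ D, u₀ < p 0) :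
    ContDiffOn ℝ ∞ (fun p : Fin 4 → ℝ => φ (p 0)) D :=
  hφ.comp (contDiff_apply ℝ ℝ 0).contDiffOn hD

/-! ### Homogeneous solutions -/

/-- `-2 M(u) / r - (Λ/3) r² + q(u)² f(r / q(u))`. -/
def potential (Λ : ℝ) (M q f : ℝ → ℝ) (p : Fin 4 → ℝ) : ℝ :=
  -2 * M (p 0) / p 1 - Λ / 3 * p 1 ^ 2 + q (p 0) ^ 2 * f (p 1 / q (p 0))

/-- `ln P` on the coordinate space. -/
def logField (P : ℝ → ℝ → ℝ → ℝ) (p : Fin 4 → ℝ) : ℝ := logP P (p 0) (p 2) (p 3)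

/-- `Δ ln P` on the coordinate space. -/
def curvatureField (P : ℝ → ℝ → ℝ → ℝ) (p : Fin 4 → ℝ) : ℝ := lap P (logP P) (p 0) (p 2) (p 3)

section potential

variable {Λ u₀ : ℝ} {M q f : ℝ → ℝ} {Z : Set ℝ} {D : Set (Fin 4 → ℝ)} {p : Fin 4 → ℝ}

theorem contDiffOn_ratio (hq : ContDiffOn ℝ ∞ q (Set.Ioi u₀)) (hq0 : ∀ u, u₀ < u → q u ≠ 0)
    (hu : ∀ z ∈ D, u₀ < z 0) : ContDiffOn ℝ ∞ (fun z : Fin 4 → ℝ => z 1 / q (z 0)) D :=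
  (contDiff_apply ℝ ℝ 1).contDiffOn.div (contDiffOn_comp_coord hq hu) fun z hz => hq0 _ (hu z hz)

theorem contDiffOn_potential (hM : ContDiffOn ℝ ∞ M (Set.Ioi u₀))
    (hq : ContDiffOn ℝ ∞ q (Set.Ioi u₀)) (hq0 : ∀ u, u₀ < u → q u ≠ 0)
    (hf : ContDiffOn ℝ ∞ f Z) (hu : ∀ z ∈ D, u₀ < z 0) (hr : ∀ z ∈ D, 0 < z 1)
    (hZ : ∀ z ∈ D, z 1 / q (z 0) ∈ Z) : ContDiffOn ℝ ∞ (potential Λ M q f) D := by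
  have h1 : ContDiffOn ℝ ∞ (fun z : Fin 4 → ℝ => z 1) D := (contDiff_apply ℝ ℝ 1).contDiffOn
  exact (((contDiffOn_const.mul (contDiffOn_comp_coord hM hu)).div h1
    fun z hz => (hr z hz).ne').sub (contDiffOn_const.mul (h1.pow 2))).add
    (((contDiffOn_comp_coord hq hu).pow 2).mul (hf.comp (contDiffOn_ratio hq hq0 hu) hZ))

theorem hasDerivAt_of_contDiffOn {φ : ℝ → ℝ} {s : Set ℝ} (hs : IsOpen s)
    (hφ : ContDiffOn ℝ ∞ φ s) {x : ℝ} (hx : x ∈ s) : HasDerivAt φ (deriv φ x) x :=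
  ((hφ.contDiffAt (hs.mem_nhds hx)).differentiableAt (by simp)).hasDerivAt

theorem pd_potential (hM : ContDiffOn ℝ ∞ M (Set.Ioi u₀))
    (hq : ContDiffOn ℝ ∞ q (Set.Ioi u₀)) (hq0 : ∀ u, u₀ < u → q u ≠ 0)
    (hZo : IsOpen Z) (hf : ContDiffOn ℝ ∞ f Z) (hu : u₀ < p 0) (hr : 0 < p 1)
    (hZ : p 1 / q (p 0) ∈ Z) (i : Fin 4) :
    pd i (potential Λ M q f) p =
      ![-2 * deriv M (p 0) / p 1 + 2 * q (p 0) * deriv q (p 0) * f (p 1 / q (p 0))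
          - p 1 * deriv q (p 0) * deriv f (p 1 / q (p 0)),
        2 * M (p 0) / p 1 ^ 2 - 2 * Λ / 3 * p 1 + q (p 0) * deriv f (p 1 / q (p 0)),
        0, 0] i := by
  have hM' := hasDerivAt_of_contDiffOn isOpen_Ioi hM hu
  have hq' := hasDerivAt_of_contDiffOn isOpen_Ioi hq hu
  have hf' := hasDerivAt_of_contDiffOn hZo hf hZ
  have hqp := hq0 _ hu
  fin_cases i
  · have h1 : HasDerivAt (fun u => p 1 / q u) (-(p 1 * deriv q (p 0)) / q (p 0) ^ 2) (p 0) := by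
      simpa using (hasDerivAt_const (p 0) (p 1)).fun_div hq' hqp
    have h2 := (((hM'.const_mul (-2)).div_const (p 1)).sub_const (Λ / 3 * p 1 ^ 2)).add
      ((hq'.fun_pow 2).fun_mul (hf'.comp (p 0) h1))
    have h3 : HasDerivAt (fun u => -2 * M u / p 1 - Λ / 3 * p 1 ^ 2 + q u ^ 2 * f (p 1 / q u))
        (-2 * deriv M (p 0) / p 1 + 2 * q (p 0) * deriv q (p 0) * f (p 1 / q (p 0))
          - p 1 * deriv q (p 0) * deriv f (p 1 / q (p 0))) (p 0) := by
      refine h2.congr_deriv ?_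
      simp
      field_simp
      ring
    simpa [pd, potential] using h3.deriv
  · have h1 : HasDerivAt (fun r => r / q (p 0)) (1 / q (p 0)) (p 1) :=
      (hasDerivAt_id (p 1)).div_const _
    have h2 := (((hasDerivAt_const (p 1) (-2 * M (p 0))).fun_div (hasDerivAt_id' (p 1)) hr.ne').sub
      (((hasDerivAt_id' (p 1)).fun_pow 2).const_mul (Λ / 3))).add
      ((hf'.comp (p 1) h1).const_mul (q (p 0) ^ 2))
    have h3 : HasDerivAt
        (fun r => -2 * M (p 0) / r - Λ / 3 * r ^ 2 + q (p 0) ^ 2 * f (r / q (p 0)))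
        (2 * M (p 0) / p 1 ^ 2 - 2 * Λ / 3 * p 1 + q (p 0) * deriv f (p 1 / q (p 0))) (p 1) := by
      refine h2.congr_deriv ?_
      simp
      field_simp
    simpa [pd, potential] using h3.deriv
  · simp [pd, potential]
  · simp [pd, potential]

theorem pd_one_pd_one_potential (hD : IsOpen D) (hM : ContDiffOn ℝ ∞ M (Set.Ioi u₀))
    (hq : ContDiffOn ℝ ∞ q (Set.Ioi u₀)) (hq0 : ∀ u, u₀ < u → q u ≠ 0)
    (hZo : IsOpen Z) (hf : ContDiffOn ℝ ∞ f Z) (hu : ∀ z ∈ D, u₀ < z 0)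
    (hr : ∀ z ∈ D, 0 < z 1) (hZ : ∀ z ∈ D, z 1 / q (z 0) ∈ Z) (hp : p ∈ D) :
    pd 1 (pd 1 (potential Λ M q f)) p =
      -4 * M (p 0) / p 1 ^ 3 - 2 * Λ / 3 + deriv (deriv f) (p 1 / q (p 0)) := by
  have hf1 : ContDiffOn ℝ ∞ (deriv f) Z := hf.deriv_of_isOpen hZo (by simp)
  have hf' := hasDerivAt_of_contDiffOn hZo hf1 (hZ p hp)
  have hqp := hq0 _ (hu p hp)
  have hrp := (hr p hp).ne'
  rw [pd_congr_of_isOpen hD (fun z hz =>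
    pd_potential hM hq hq0 hZo hf (hu z hz) (hr z hz) (hZ z hz) 1) hp]
  have h1 : HasDerivAt (fun r => r / q (p 0)) (1 / q (p 0)) (p 1) :=
    (hasDerivAt_id (p 1)).div_const _
  have h2 := (((hasDerivAt_const (p 1) (2 * M (p 0))).fun_div ((hasDerivAt_id' (p 1)).fun_pow 2)
    (pow_ne_zero 2 hrp)).sub ((hasDerivAt_id' (p 1)).const_mul (2 * Λ / 3))).add
    ((hf'.comp (p 1) h1).const_mul (q (p 0)))
  have h3 : HasDerivAt
      (fun r => 2 * M (p 0) / r ^ 2 - 2 * Λ / 3 * r + q (p 0) * deriv f (r / q (p 0)))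
      (-4 * M (p 0) / p 1 ^ 3 - 2 * Λ / 3 + deriv (deriv f) (p 1 / q (p 0))) (p 1) := by
    refine h2.congr_deriv ?_
    simp
    field_simp
    ring
  simpa [pd] using h3.deriv

end potential

/-! ### The radial equation and its consequence for the angular equation -/

section ode

/-- The angular Einstein equation follows from the radial one and the Maxwell equation. -/
theorem angular_of_radial {Z : Set ℝ} (hZo : IsOpen Z) {L f e : ℝ → ℝ} {c : ℝ}
    (hf : ContDiffOn ℝ ∞ f Z) (he : ContDiffOn ℝ ∞ e Z) (he0 : ∀ z ∈ Z, 0 < e z)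
    (hL : ∀ z ∈ Z, HasDerivAt L (c / (z ^ 2 * e z)) (-2 * e z ^ 2))
    (hode : ∀ z ∈ Z, f z + z * deriv f z = z ^ 2 * L (-2 * e z ^ 2) / 2 + 2 * c * e z)
    {z : ℝ} (hz : z ∈ Z) (hz0 : z ≠ 0) :
    deriv (deriv f) z / 2 + deriv f z / z = L (-2 * e z ^ 2) / 2 := by
  have hf1 : ContDiffOn ℝ ∞ (deriv f) Z := hf.deriv_of_isOpen hZo (by simp)
  have df := hasDerivAt_of_contDiffOn hZo hf hz
  have df1 := hasDerivAt_of_contDiffOn hZo hf1 hz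
  have de := hasDerivAt_of_contDiffOn hZo he hz
  -- Both sides of the radial equation are differentiated. By the chain rule z² 𝓛(-2e²)/2
  -- contributes z 𝓛 - 2 c e', and the -2 c e' cancels the derivative of 2 c e, leaving 2 f' + z f''
  -- = z 𝓛.
  have h1 := df.fun_add ((hasDerivAt_id' z).fun_mul df1)
  have h2 := ((((hasDerivAt_id' z).fun_pow 2).fun_mul
    ((hL z hz).comp z ((de.fun_pow 2).const_mul (-2)))).div_const 2).fun_add (de.const_mul (2 * c))
  have h3 := h1.unique (h2.congr_of_eventuallyEq
    (eventually_of_mem (hZo.mem_nhds hz) fun y hy => hode y hy))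
  have he' := (he0 z hz).ne'
  simp only [Function.comp_def] at h3
  field_simp at h3 ⊢
  simp at h3
  refine mul_left_cancel₀ he' ?_
  linear_combination h3 / 2

end ode

/-! ### The ansatz in warped form, and its Einstein and Maxwell equations -/

section fields

variable {Λ u₀ : ℝ} {S B : Set (ℝ × ℝ)} {P : ℝ → ℝ → ℝ → ℝ} {m q C₁ f e L : ℝ → ℝ}
  {Q : ℝ → ℝ → ℝ} {Z : Set ℝ} {D : Set (Fin 4 → ℝ)} {p : Fin 4 → ℝ}

theorem contDiffOn_logField (h : AdmissibleData u₀ S P m q C₁)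
    (hD : ∀ z ∈ D, u₀ < z 0 ∧ (z 2, z 3) ∈ S) : ContDiffOn ℝ ∞ (logField P) D := by
  have h1 : ContDiff ℝ ∞ fun z : Fin 4 → ℝ => (z 0, z 2, z 3) := by fun_prop
  exact (h.smooth_P.comp h1.contDiffOn fun z hz => ⟨(hD z hz).1, (hD z hz).2⟩).log
    fun z hz => (h.pos_P _ _ _ (hD z hz).1 (hD z hz).2).ne'

theorem exp_two_mul_logField (h : AdmissibleData u₀ S P m q C₁)
    (hp : u₀ < p 0 ∧ (p 2, p 3) ∈ S) :
    Real.exp (2 * logField P p) = P (p 0) (p 2) (p 3) ^ 2 := by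
  rw [logField, logP, mul_comm, Real.exp_mul, Real.exp_log (h.pos_P _ _ _ hp.1 hp.2)]
  norm_cast

theorem curvatureField_eq (h : AdmissibleData u₀ S P m q C₁) (hp : u₀ < p 0 ∧ (p 2, p 3) ∈ S) :
    curvatureField P p = Real.exp (2 * logField P p)
      * (pd 2 (pd 2 (logField P)) p + pd 3 (pd 3 (logField P)) p) := by
  rw [exp_two_mul_logField h hp]
  exact lap_eq_pd P (logP P) p

theorem contDiffOn_curvatureField (h : AdmissibleData u₀ S P m q C₁) (hDo : IsOpen D)
    (hD : ∀ z ∈ D, u₀ < z 0 ∧ (z 2, z 3) ∈ S) : ContDiffOn ℝ ∞ (curvatureField P) D := by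
  have hW := contDiffOn_logField h hD
  have h2W : ContDiffOn ℝ ∞ (fun z => 2 * logField P z) D := contDiffOn_const.mul hW
  refine (h2W.exp.mul ((contDiffOn_pd hDo (contDiffOn_pd hDo hW 2) 2).add
    (contDiffOn_pd hDo (contDiffOn_pd hDo hW 3) 3))).congr fun z hz => ?_
  exact curvatureField_eq h (hD z hz)

theorem areaFactor_logField (h : AdmissibleData u₀ S P m q C₁)
    (hp : u₀ < p 0 ∧ (p 2, p 3) ∈ S) :
    areaFactor (logField P) p = p 1 ^ 2 / P (p 0) (p 2) (p 3) ^ 2 := by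
  rw [← exp_two_mul_logField h hp, areaFactor, neg_mul, Real.exp_neg]
  rfl

theorem metric_eq_warpedMetric (h : AdmissibleData u₀ S P m q C₁)
    (hp : u₀ < p 0 ∧ (p 2, p 3) ∈ S) (hr : 0 < p 1)
    (hQ : Q (p 0) (p 1) = C₁ (p 0) / p 1 + q (p 0) ^ 2 * f (p 1 / q (p 0))) :
    metric Λ P m Q p = warpedMetric (fun z => curvatureField P z - 2 * z 1 * pd 0 (logField P) z
      + potential Λ (fun u => m u - C₁ u / 2) q f z) (logField P) p := by
  have h1 : twoH Λ P m (p 0) (p 1) (p 2) (p 3) + Q (p 0) (p 1)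
      = curvatureField P p - 2 * p 1 * pd 0 (logField P) p
        + potential Λ (fun u => m u - C₁ u / 2) q f p := by
    have h2 : pd 0 (logField P) p = logPu P (p 0) (p 2) (p 3) := (logPu_eq_pd P p).symm
    rw [h2, hQ, twoH, curvatureField, potential]
    field_simp
    ring
  simp only [metric, warpedMetric, h1, areaFactor_logField h hp]

theorem lap_lap_logP (h : AdmissibleData u₀ S P m q C₁) (hp : u₀ < p 0 ∧ (p 2, p 3) ∈ S) :
    Real.exp (2 * logField P p)
      * (pd 2 (pd 2 (curvatureField P)) p + pd 3 (pd 3 (curvatureField P)) p)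
      = lap P (lap P (logP P)) (p 0) (p 2) (p 3) := by
  rw [exp_two_mul_logField h hp]
  exact (lap_eq_pd P (lap P (logP P)) p).symm

/-- Evaluate W_u (r V_r - 2V) + V_u summand by summand: -2M/r gives (6 M W_u - 2 M_u)/r, -(Λ/3) r²
gives 0, and by Euler's identity q² f(r/q) gives (q_u - q W_u)(2 q f - r f'). -/
theorem einstein_metric (h : AdmissibleData u₀ S P m q C₁) (hBo : IsOpen B)
    (hB : ∀ u r, (u, r) ∈ B → u₀ < u ∧ 0 < r ∧ r / q u ∈ Z) (hZo : IsOpen Z)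
    (hf : ContDiffOn ℝ ∞ f Z)
    (hQ : ∀ u r, (u, r) ∈ B → Q u r = C₁ u / r + q u ^ 2 * f (r / q u))
    (hp : p ∈ domain B S) (μ ν : Fin 4) :
    einstein (metric Λ P m Q) μ ν p =
      (fun X N Y => !![X, 0, 0, 0; -N, X, 0, 0; 0, 0, Y, 0; 0, 0, 0, Y] μ ν)
      ((f (p 1 / q (p 0)) + p 1 / q (p 0) * deriv f (p 1 / q (p 0))) / (p 1 / q (p 0)) ^ 2 - Λ)
      ((lap P (lap P (logP P)) (p 0) (p 2) (p 3)
          + 12 * (m (p 0) - C₁ (p 0) / 2) * logPu P (p 0) (p 2) (p 3)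
          - 4 * deriv (fun u => m u - C₁ u / 2) (p 0)) / (2 * p 1 ^ 2)
        + (deriv q (p 0) - q (p 0) * logPu P (p 0) (p 2) (p 3))
          * (2 * q (p 0) * f (p 1 / q (p 0)) - p 1 * deriv f (p 1 / q (p 0))) / p 1)
      (deriv (deriv f) (p 1 / q (p 0)) / 2 + deriv f (p 1 / q (p 0)) / (p 1 / q (p 0)) - Λ) := by
  have hDo : IsOpen (domain B S) := isOpen_domain hBo h.isOpen
  have hD : ∀ z ∈ domain B S, u₀ < z 0 ∧ (z 2, z 3) ∈ S := fun z hz => ⟨(hB _ _ hz.1).1, hz.2⟩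
  have hu : ∀ z ∈ domain B S, u₀ < z 0 := fun z hz => (hD z hz).1
  have hr : ∀ z ∈ domain B S, 0 < z 1 := fun z hz => (hB _ _ hz.1).2.1
  have hZ : ∀ z ∈ domain B S, z 1 / q (z 0) ∈ Z := fun z hz => (hB _ _ hz.1).2.2
  have hM : ContDiffOn ℝ ∞ (fun u => m u - C₁ u / 2) (Set.Ioi u₀) :=
    h.smooth_m.sub (h.smooth_C₁.div_const 2)
  have hpV := pd_potential (Λ := Λ) hM h.smooth_q h.q_ne_zero hZo hf (hu p hp) (hr p hp) (hZ p hp)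
  have hWu : pd 0 (logField P) p = logPu P (p 0) (p 2) (p 3) := (logPu_eq_pd P p).symm
  rw [einstein_congr hDo (fun z hz => metric_eq_warpedMetric h (hD z hz) (hr z hz)
      (hQ _ _ hz.1)) hp,
    einstein_warpedMetric hDo hr (contDiffOn_logField h hD)
      (fun z _ => by simp [pd, logField]) (contDiffOn_curvatureField h hDo hD)
      (fun z _ => by simp [pd, curvatureField])
      (contDiffOn_potential hM h.smooth_q h.q_ne_zero hf hu hr hZ)
      (fun z _ => by simp [pd, potential]) (fun z _ => by simp [pd, potential])
      (fun z hz => curvatureField_eq h (hD z hz)) hp,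
    lap_lap_logP h (hD p hp), hWu, hpV 0, hpV 1,
    pd_one_pd_one_potential hDo hM h.smooth_q h.q_ne_zero hZo hf hu hr hZ hp]
  have hqp := h.q_ne_zero _ (hu p hp)
  have hrp := (hr p hp).ne'
  congr 1
  · simp only [potential, Matrix.cons_val_one, Matrix.cons_val_zero]
    field_simp
    ring
  · simp only [potential, Matrix.cons_val_one, Matrix.cons_val_zero]
    field_simp
    ring
  · simp only [Matrix.cons_val_one, Matrix.cons_val_zero]
    field_simp
    ring

/-- The relation z² 𝓛_F e = c reduces the differentiated quantity to ± c q² e^{-2W}. Its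
r-derivative vanishes identically, and its u-derivative is a nonzero multiple of q_u - q W_u. -/
theorem maxwell_iff (h : AdmissibleData u₀ S P m q C₁) (hBo : IsOpen B)
    (hB : ∀ u r, (u, r) ∈ B → u₀ < u ∧ 0 < r ∧ r / q u ∈ Z)
    (he0 : ∀ z ∈ Z, 0 < e z) {c : ℝ} (hc : c ≠ 0)
    (hL : ∀ z ∈ Z, HasDerivAt L (c / (z ^ 2 * e z)) (-2 * e z ^ 2))
    {E : ℝ → ℝ → ℝ} (hE : ContDiffOn ℝ ∞ (fun z : ℝ × ℝ => E z.1 z.2) B)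
    (hEe : ∀ u r, (u, r) ∈ B → E u r ^ 2 = e (r / q u) ^ 2) (hp : p ∈ domain B S) :
    (∀ i : Fin 4, i = 0 ∨ i = 1 → pd i (fun z => areaFactor (logField P) z
        * deriv L (-2 * E (z 0) (z 1) ^ 2) * E (z 0) (z 1)) p = 0) ↔
      deriv q (p 0) = q (p 0) * logPu P (p 0) (p 2) (p 3) := by
  have hDo : IsOpen (domain B S) := isOpen_domain hBo h.isOpen
  have hD : ∀ z ∈ domain B S, u₀ < z 0 ∧ (z 2, z 3) ∈ S := fun z hz => ⟨(hB _ _ hz.1).1, hz.2⟩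
  have hu : ∀ z ∈ domain B S, u₀ < z 0 := fun z hz => (hD z hz).1
  have hDn := hDo.mem_nhds hp
  have hW := contDiffOn_logField h hD
  have hcE : ContinuousAt (fun z : Fin 4 → ℝ => E (z 0) (z 1)) p := by
    have h1 : ContinuousAt (fun z : ℝ × ℝ => E z.1 z.2) (p 0, p 1) :=
      hE.continuousOn.continuousAt (hBo.mem_nhds hp.1)
    have h2 : ContinuousAt (fun z : Fin 4 → ℝ => (z 0, z 1)) p := by fun_prop
    exact ContinuousAt.comp (f := fun z : Fin 4 → ℝ => (z 0, z 1)) h1 h2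
  have hE0 : E (p 0) (p 1) ≠ 0 := fun h0 => by
    have h1 := hEe _ _ hp.1
    have h2 := he0 _ (hB _ _ hp.1).2.2
    rw [h0] at h1
    nlinarith
  -- The invariant fixes only E², but E is continuous and nonzero, so its sign σ is constant near p.
  obtain ⟨σ, hσ, hσE⟩ : ∃ σ : ℝ, σ ≠ 0 ∧
      ∀ᶠ z in 𝓝 p, E (z 0) (z 1) = σ * e (z 1 / q (z 0)) := by
    rcases lt_or_gt_of_ne hE0 with hneg | hpos
    · refine ⟨-1, by norm_num, ?_⟩
      filter_upwards [hcE.eventually_lt continuousAt_const hneg, hDn] with z hz hzD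
      rcases sq_eq_sq_iff_eq_or_eq_neg.1 (hEe _ _ hzD.1) with h1 | h1
      · linarith [he0 _ (hB _ _ hzD.1).2.2]
      · linarith
    · refine ⟨1, one_ne_zero, ?_⟩
      filter_upwards [continuousAt_const.eventually_lt hcE hpos, hDn] with z hz hzD
      rcases sq_eq_sq_iff_eq_or_eq_neg.1 (hEe _ _ hzD.1) with h1 | h1
      · linarith
      · linarith [he0 _ (hB _ _ hzD.1).2.2]
  have hev : (fun z => areaFactor (logField P) z
        * deriv L (-2 * E (z 0) (z 1) ^ 2) * E (z 0) (z 1)) =ᶠ[𝓝 p]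
      fun z => σ * c * (q (z 0) ^ 2 * Real.exp (-2 * logField P z)) := by
    filter_upwards [hσE, hDn] with z hz hzD
    obtain ⟨h1, h2, h3⟩ := hB _ _ hzD.1
    have h4 := h.q_ne_zero _ h1
    have h5 := (he0 _ h3).ne'
    rw [hEe _ _ hzD.1, (hL _ h3).deriv, hz, areaFactor]
    field_simp
  have hdW := differentiableAt_of_contDiffOn hDo hW hp
  have hdq : DifferentiableAt ℝ (fun z : Fin 4 → ℝ => q (z 0)) p :=
    differentiableAt_of_contDiffOn hDo (contDiffOn_comp_coord h.smooth_q hu) hp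
  have hdW2 : DifferentiableAt ℝ (fun z => -2 * logField P z) p := hdW.const_mul _
  have hpd : ∀ i, pd i (fun z => areaFactor (logField P) z
        * deriv L (-2 * E (z 0) (z 1) ^ 2) * E (z 0) (z 1)) p
      = 2 * σ * c * q (p 0) * Real.exp (-2 * logField P p)
        * (pd i (fun z => q (z 0)) p - q (p 0) * pd i (logField P) p) := by
    intro i
    rw [pd_congr hev, pd_const_mul, pd_mul (hdq.fun_pow 2) hdW2.exp, pd_pow hdq, pd_exp hdW2,
      pd_const_mul]
    push_cast
    ring
  have hq0 : pd 0 (fun z => q (z 0)) p = deriv q (p 0) := by simp [pd]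
  have hW0 : pd 0 (logField P) p = logPu P (p 0) (p 2) (p 3) := (logPu_eq_pd P p).symm
  have hq1 : pd 1 (fun z => q (z 0)) p = 0 := by simp [pd]
  have hW1 : pd 1 (logField P) p = 0 := by simp [pd, logField]
  have hqp := h.q_ne_zero _ (hu p hp)
  have hexp := Real.exp_ne_zero (-2 * logField P p)
  constructor
  · intro H
    have h0 := H 0 (Or.inl rfl)
    rw [hpd, hq0, hW0] at h0
    have h1 : 2 * σ * c * q (p 0) * Real.exp (-2 * logField P p) ≠ 0 := by positivity
    exact sub_eq_zero.1 ((mul_eq_zero.1 h0).resolve_left h1)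
  · rintro H i (rfl | rfl)
    · rw [hpd, hq0, hW0, H, sub_self, mul_zero]
    · rw [hpd, hq1, hW1, mul_zero, sub_self, mul_zero]

end fields

section fields

variable {Λ u₀ : ℝ} {S B : Set (ℝ × ℝ)} {P : ℝ → ℝ → ℝ → ℝ} {m q C₁ f e L : ℝ → ℝ}
  {Q Finv : ℝ → ℝ → ℝ} {Z : Set ℝ}

theorem chargeRestriction_iff (h : AdmissibleData u₀ S P m q C₁) :
    ChargeRestriction u₀ S P q ↔
      ∀ u x y, u₀ < u → (x, y) ∈ S → deriv q u = q u * logPu P u x y := by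
  refine forall₃_congr fun u x y => forall₂_congr fun hu hxy => ?_
  have hP := (h.pos_P u x y hu hxy).ne'
  have hopen : IsOpen (Set.Ioi u₀ ×ˢ S) := isOpen_Ioi.prod h.isOpen
  have h1 : DifferentiableAt ℝ (fun z : ℝ × ℝ × ℝ => P z.1 z.2.1 z.2.2) (u, x, y) :=
    (h.smooth_P.contDiffAt (hopen.mem_nhds (Set.mk_mem_prod hu hxy))).differentiableAt (by simp)
  have h2 : DifferentiableAt ℝ (fun v : ℝ => (v, x, y)) u := by fun_prop
  have h3 : DifferentiableAt ℝ (fun v => P v x y) u :=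
    DifferentiableAt.comp (f := fun v : ℝ => (v, x, y)) u h1 h2
  have h4 : logPu P u x y = deriv (fun v => P v x y) u / P u x y := by
    rw [logPu]
    exact deriv.log h3 hP
  rw [h4]
  field_simp
  constructor <;> intro H <;> linarith

theorem isOpen_of_ratio (hq : ContDiffOn ℝ ∞ q (Set.Ioi u₀)) (hq0 : ∀ u, u₀ < u → q u ≠ 0)
    (hZo : IsOpen Z) (hB : ∀ u r, (u, r) ∈ B ↔ u₀ < u ∧ 0 < r ∧ r / q u ∈ Z) : IsOpen B := by
  have hU : IsOpen (Set.Ioi u₀ ×ˢ Set.Ioi (0 : ℝ)) := isOpen_Ioi.prod isOpen_Ioi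
  have h1 : ContinuousOn (fun z : ℝ × ℝ => z.2 / q z.1) (Set.Ioi u₀ ×ˢ Set.Ioi (0 : ℝ)) :=
    continuous_snd.continuousOn.div
      (hq.continuousOn.comp continuous_fst.continuousOn fun z hz => hz.1) fun z hz => hq0 _ hz.1
  have h2 := h1.isOpen_inter_preimage hU hZo
  convert h2 using 1
  ext ⟨u, r⟩
  simp [hB, and_assoc]

/-- The metric with `Q = C₁/r + q² f(r/q)` and the Maxwell field of size `e(r/q)` solve the field
equations exactly when the Robinson-Trautman equation and the charge restriction hold, provided
that `r² 𝓛_F e = c q²` and `f` solves the radial Einstein equation. -/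
theorem solvesExactly_of_homogeneous (h : AdmissibleData u₀ S P m q C₁)
    (hZo : IsOpen Z)
    (hB : ∀ u r, (u, r) ∈ B ↔ u₀ < u ∧ 0 < r ∧ r / q u ∈ Z)
    (hBne : ∀ u, u₀ < u → ∃ r, (u, r) ∈ B)
    (hf : ContDiffOn ℝ ∞ f Z) (he : ContDiffOn ℝ ∞ e Z) (he0 : ∀ z ∈ Z, 0 < e z)
    {c : ℝ} (hc : c ≠ 0) (hL : ∀ z ∈ Z, HasDerivAt L (c / (z ^ 2 * e z)) (-2 * e z ^ 2))
    (hode : ∀ z ∈ Z, f z + z * deriv f z = z ^ 2 * L (-2 * e z ^ 2) / 2 + 2 * c * e z)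
    (hF : ∀ u r, (u, r) ∈ B → Finv u r = -2 * e (r / q u) ^ 2)
    (hQ : ∀ u r, (u, r) ∈ B → Q u r = C₁ u / r + q u ^ 2 * f (r / q u)) :
    SolvesExactlyWhenRestricted Λ u₀ B S L Finv Q P m q C₁ := by
  have hBo := isOpen_of_ratio h.smooth_q h.q_ne_zero hZo hB
  have hB' : ∀ u r, (u, r) ∈ B → u₀ < u ∧ 0 < r ∧ r / q u ∈ Z := fun u r => (hB u r).1
  have hDo : IsOpen (domain B S) := isOpen_domain hBo h.isOpen
  have hD : ∀ z ∈ domain B S, u₀ < z 0 ∧ (z 2, z 3) ∈ S := fun z hz => ⟨(hB' _ _ hz.1).1, hz.2⟩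
  have hr : ∀ z ∈ domain B S, 0 < z 1 := fun z hz => (hB' _ _ hz.1).2.1
  have hg := fun z (hz : z ∈ domain B S) =>
    metric_eq_warpedMetric (Λ := Λ) h (hD z hz) (hr z hz) (hQ _ _ hz.1)
  refine ⟨⟨fun u r => e (r / q u), ?_, fun p hp => ?_⟩, fun E hE hinv => ?_⟩
  · have h1 : ContDiffOn ℝ ∞ (fun z : ℝ × ℝ => z.2 / q z.1) B :=
      contDiff_snd.contDiffOn.div
        (h.smooth_q.comp contDiff_fst.contDiffOn fun z hz => (hB' z.1 z.2 hz).1)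
        fun z hz => h.q_ne_zero _ (hB' z.1 z.2 hz).1
    exact he.comp h1 fun z hz => (hB' z.1 z.2 hz).2.2
  · rw [fieldInvariant_faraday _ (hg p hp) (hr p hp), hF _ _ hp.1]
  have hEe : ∀ u r, (u, r) ∈ B → E u r ^ 2 = e (r / q u) ^ 2 := by
    intro u r hur
    obtain ⟨⟨x, y⟩, hxy⟩ := h.nonempty
    -- The invariant is prescribed at spacetime points, so any point of the nonempty S serves to
    -- read off E² as a function of u and r.
    have hp : (![u, r, x, y] : Fin 4 → ℝ) ∈ domain B S := ⟨hur, hxy⟩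
    have h1 := hinv _ hp
    rw [fieldInvariant_faraday _ (hg _ hp) (hr _ hp), hF _ _ hp.1] at h1
    exact mul_left_cancel₀ (by norm_num) h1
  have hmax := fun p (hp : p ∈ domain B S) =>
    (maxwell_faraday_iff L E hDo hr hg hp).trans (maxwell_iff h hBo hB' he0 hc hL hE hEe hp)
  have hein := fun p (hp : p ∈ domain B S) =>
    einstein_metric (Λ := Λ) h hBo hB' hZo hf hQ hp
  constructor
  · intro H
    have hch : ∀ u x y, u₀ < u → (x, y) ∈ S → deriv q u = q u * logPu P u x y := by
      intro u x y hu hxy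
      obtain ⟨r, hur⟩ := hBne u hu
      have hp : (![u, r, x, y] : Fin 4 → ℝ) ∈ domain B S := ⟨hur, hxy⟩
      exact (hmax _ hp).1 (H _ hp).2.2
    refine ⟨fun u x y hu hxy => ?_, (chargeRestriction_iff h).2 hch⟩
    obtain ⟨r, hur⟩ := hBne u hu
    have hp : (![u, r, x, y] : Fin 4 → ℝ) ∈ domain B S := ⟨hur, hxy⟩
    -- The (r, u) component has no matter source and, given the charge restriction, equals minus the
    -- Robinson-Trautman expression over 2r².
    have h1 := (H _ hp).1 1 0
    rw [hein _ hp, energyMomentum_faraday L E (hg _ hp) (hr _ hp)] at h1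
    have hr0 := (hB' u r hur).2.1.ne'
    simp [delta, hch u x y hu hxy, hr0] at h1
    simpa using h1
  · rintro ⟨hRT, hch⟩ p hp
    rw [chargeRestriction_iff h] at hch
    refine ⟨fun μ ν => ?_, pd_faraday_cyclic E p, ?_⟩
    · have hZp := (hB' _ _ hp.1).2.2
      have hr0 := (hr p hp).ne'
      have hz0 : p 1 / q (p 0) ≠ 0 := div_ne_zero hr0 (h.q_ne_zero _ (hD p hp).1)
      have hRTp := hRT _ _ _ (hD p hp).1 hp.2
      have hY := angular_of_radial hZo hf he he0 hL hode hZp hz0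
      have he' := (he0 _ hZp).ne'
      rw [hein p hp, energyMomentum_faraday L E (hg _ hp) (hr _ hp), hEe _ _ hp.1,
        (hL _ hZp).deriv, hode _ hZp, hY, hRTp, hch _ _ _ (hD p hp).1 hp.2]
      -- The radial ODE divided by z² is the (u, u) equation, because 2 e² 𝓛_F = 2 c e / z².
      have hX : ((p 1 / q (p 0)) ^ 2 * L (-2 * e (p 1 / q (p 0)) ^ 2) / 2
            + 2 * c * e (p 1 / q (p 0))) / (p 1 / q (p 0)) ^ 2
          = L (-2 * e (p 1 / q (p 0)) ^ 2) / 2 + 2 * e (p 1 / q (p 0)) ^ 2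
            * (c / ((p 1 / q (p 0)) ^ 2 * e (p 1 / q (p 0)))) := by
        generalize p 1 / q (p 0) = z at *
        field_simp
      rw [hX]
      fin_cases μ <;> fin_cases ν <;> simp [delta]
    · exact (hmax p hp).2 (hch _ _ _ (hD p hp).1 hp.2)

end fields

/-! ### Primitives -/

theorem hasDerivAt_primitive {w : ℝ → ℝ} (hw : Continuous w) (z : ℝ) :
    HasDerivAt (fun z => ∫ t in (0 : ℝ)..z, w t) (w z) z :=
  intervalIntegral.integral_hasDerivAt_right (hw.intervalIntegrable _ _)
    (hw.stronglyMeasurableAtFilter _ _) hw.continuousAt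

theorem contDiff_primitive {w : ℝ → ℝ} (hw : ContDiff ℝ ∞ w) :
    ContDiff ℝ ∞ (fun z => ∫ t in (0 : ℝ)..z, w t) := by
  have h := hasDerivAt_primitive hw.continuous
  refine contDiff_infty_iff_deriv.2 ⟨fun z => (h z).differentiableAt, ?_⟩
  rwa [show deriv (fun z => ∫ t in (0 : ℝ)..z, w t) = w from funext fun z => (h z).deriv]

/-- Substitute s = a t. With a = q the integral scales as q³, the weight of the term κ q³, so the
whole primitive is q³ times a function of r/q. -/
theorem integral_eq_cube_mul {w v : ℝ → ℝ} {a : ℝ} (h : ∀ t, w (a * t) = a ^ 2 * v t) (z : ℝ) :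
    ∫ s in (0 : ℝ)..a * z, w s = a ^ 3 * ∫ t in (0 : ℝ)..z, v t := by
  have h1 := intervalIntegral.mul_integral_comp_mul_left (f := w) (a := 0) (b := z) a
  rw [mul_zero] at h1
  rw [← h1]
  simp only [h, intervalIntegral.integral_const_mul]
  ring

theorem isOpen_ne_zero : IsOpen {z : ℝ | z ≠ 0} := isOpen_ne

theorem mem_fullRange_iff {u₀ : ℝ} {q : ℝ → ℝ} (hq0 : ∀ u, u₀ < u → q u ≠ 0) (u r : ℝ) :
    (u, r) ∈ fullRange u₀ ↔ u₀ < u ∧ 0 < r ∧ r / q u ∈ {z : ℝ | z ≠ 0} :=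
  ⟨fun h => ⟨h.1, h.2, div_ne_zero h.2.ne' (hq0 u h.1)⟩, fun h => ⟨h.1, h.2.1⟩⟩

theorem exists_mem_fullRange {u₀ : ℝ} (u : ℝ) (hu : u₀ < u) : ∃ r, (u, r) ∈ fullRange u₀ :=
  ⟨1, hu, one_pos⟩

/-! ### The five models -/

section models

variable {Λ u₀ : ℝ} {S : Set (ℝ × ℝ)} {P : ℝ → ℝ → ℝ → ℝ} {m q C₁ : ℝ → ℝ}

theorem solvesExactly_maxwell (h : AdmissibleData u₀ S P m q C₁) :
    SolvesExactlyWhenRestricted Λ u₀ (fullRange u₀) S maxwellL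
      (maxwellF q) (maxwellQ q C₁) P m q C₁ := by
  have hs : ContDiffOn ℝ ∞ (fun z : ℝ => 1 / z ^ 2) {z | z ≠ 0} :=
    contDiffOn_const.div (contDiff_id.contDiffOn.pow 2) fun z hz => pow_ne_zero 2 hz
  -- Here and below f and e are read off from Q and F at r = q z, and c from z² 𝓛_F e. The domain is
  -- z ≠ 0 rather than z > 0 because q may be negative.
  refine solvesExactly_of_homogeneous (f := fun z => 1 / z ^ 2) (e := fun z => 1 / z ^ 2)
    (c := -1) h isOpen_ne_zero
    (mem_fullRange_iff h.q_ne_zero) exists_mem_fullRange hs hs (fun z hz => ?_)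
    (by norm_num) (fun z hz => ?_) (fun z hz => ?_) (fun u r hur => ?_) (fun u r hur => ?_)
  · have : z ≠ 0 := hz
    positivity
  · have : z ≠ 0 := hz
    refine (hasDerivAt_neg _).congr_deriv ?_
    field_simp
  · have : z ≠ 0 := hz
    have h1 : HasDerivAt (fun z : ℝ => 1 / z ^ 2) (-2 / z ^ 3) z := by
      refine ((hasDerivAt_const z (1 : ℝ)).fun_div ((hasDerivAt_id' z).fun_pow 2)
        (pow_ne_zero 2 this)).congr_deriv ?_
      field_simp
      norm_num
      ring
    rw [h1.deriv, maxwellL]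
    field_simp
  · have := hur.2.ne'
    have := h.q_ne_zero u hur.1
    rw [maxwellF]
    field_simp
  · have := hur.2.ne'
    have := h.q_ne_zero u hur.1
    rw [maxwellQ]
    field_simp
    ring

theorem solvesExactly_new2 {β : ℝ} (hβ : 0 < β) (h : AdmissibleData u₀ S P m q C₁)
    (hq : ∀ u, u₀ < u → 0 < q u) :
    SolvesExactlyWhenRestricted Λ u₀ (innerRange u₀ β q) S (new2L β)
      (new2F β q) (new2Q β q C₁) P m q C₁ := by
  have h2 : (0 : ℝ) < Real.sqrt 2 := by positivity
  have h22 : Real.sqrt 2 ^ 2 = 2 := Real.sq_sqrt (by norm_num)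
  have hpos : ∀ z ∈ Set.Ioo 0 (β / 2), 0 < β - z := fun z hz => by
    linarith [hz.1, hz.2]
  -- Thus √(-F) = β - z along the solution, and the Lagrangian is simply 1/z.
  have hX : ∀ z ∈ Set.Ioo 0 (β / 2), Real.sqrt (-(-2 * ((β - z) / Real.sqrt 2) ^ 2)) = β - z :=
    fun z hz => by
      rw [div_pow, h22, ← Real.sqrt_sq (hpos z hz).le]
      congr 1
      rw [Real.sqrt_sq (hpos z hz).le]
      ring
  have hB : ∀ u r, (u, r) ∈ innerRange u₀ β q ↔
      u₀ < u ∧ 0 < r ∧ r / q u ∈ Set.Ioo 0 (β / 2) := by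
    intro u r
    refine and_congr_right fun hu => and_congr_right fun hr => ?_
    have hqu := hq u hu
    have hr' : 0 < r := hr
    rw [Set.mem_Ioo, and_iff_right (by positivity), div_lt_iff₀ hqu]
    constructor <;> intro H <;> simp only at H ⊢ <;> linarith
  refine solvesExactly_of_homogeneous (f := fun z => -β / 2 + z / 2)
    (e := fun z => (β - z) / Real.sqrt 2) (c := -1 / (2 * Real.sqrt 2)) h isOpen_Ioo
    hB (fun u hu => ⟨β * q u / 4, (?_ : _ ∧ _ ∧ _)⟩)
    (by fun_prop) (by fun_prop) (fun z hz => div_pos (hpos z hz) h2)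
    (by have := h2.ne'; positivity) (fun z hz => ?_) (fun z hz => ?_)
    (fun u r hur => ?_) (fun u r hur => ?_)
  · have := mul_pos hβ (hq u hu)
    exact ⟨hu, by simp only; linarith, by simp only; linarith⟩
  · have hz0 := hz.1.ne'
    have hbz := hpos z hz
    have h3 : -(-2 * ((β - z) / Real.sqrt 2) ^ 2) ≠ 0 := by
      rw [neg_mul, neg_neg]; positivity
    have h4 := (hasDerivAt_neg (-2 * ((β - z) / Real.sqrt 2) ^ 2)).sqrt h3
    have h5 := (hasDerivAt_const _ (1 : ℝ)).fun_div (h4.const_sub β)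
      (by rw [hX z hz]; simpa using hz0)
    refine h5.congr_deriv ?_
    rw [hX z hz, sub_sub_cancel]
    field_simp
    norm_num
  · have hz0 := hz.1.ne'
    have h1 : HasDerivAt (fun z : ℝ => -β / 2 + z / 2) (1 / 2) z :=
      ((hasDerivAt_id' z).div_const 2).const_add _
    rw [h1.deriv, new2L, hX z hz, sub_sub_cancel]
    field_simp
    rw [h22]
    ring
  · have := (h.q_ne_zero u hur.1)
    rw [new2F, div_pow, h22]
    field_simp
  · have := hur.2.1.ne'
    have := h.q_ne_zero u hur.1
    rw [new2Q]
    field_simp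
    ring

theorem solvesExactly_new1 {α β : ℝ} (hβ : 0 < β)
    (hαβ : β ^ 2 = Real.sqrt 2 * α ^ 2) (h : AdmissibleData u₀ S P m q C₁) :
    SolvesExactlyWhenRestricted Λ u₀ (fullRange u₀) S (new1L α)
      (new1F β q) (new1Q β q C₁) P m q C₁ := by
  have h2 : (0 : ℝ) < Real.sqrt 2 := by positivity
  have h22 : Real.sqrt 2 ^ 2 = 2 := Real.sq_sqrt (by norm_num)
  have hα2 : α ^ 2 = β ^ 2 / Real.sqrt 2 := by field_simp; linarith
  have hα4 : α ^ 4 = β ^ 4 / 2 := by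
    rw [show α ^ 4 = (α ^ 2) ^ 2 by ring, hα2, div_pow, h22]; ring
  have hX : ∀ z : ℝ, Real.sqrt (-(-2 * (1 / (z ^ 2 + β ^ 2)) ^ 2))
      = Real.sqrt 2 / (z ^ 2 + β ^ 2) := fun z => by
    rw [neg_mul, neg_neg, Real.sqrt_mul (by norm_num), Real.sqrt_sq (by positivity)]
    ring
  -- The normalization β² = √2 α² is exactly what makes the argument of the logarithm collapse to
  -- this quotient.
  have hY : ∀ z : ℝ, 1 - α ^ 2 * (Real.sqrt 2 / (z ^ 2 + β ^ 2)) = z ^ 2 / (z ^ 2 + β ^ 2) :=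
    fun z => by
      rw [hα2]
      field_simp
      ring
  have hsum : ∀ z : ℝ, z ^ 2 + β ^ 2 ≠ 0 := fun z => by positivity
  have hid : ∀ s : Set ℝ, ContDiffOn ℝ ∞ (fun z : ℝ => z) s := fun s => contDiffOn_id
  have he : ∀ s : Set ℝ, ContDiffOn ℝ ∞ (fun z : ℝ => 1 / (z ^ 2 + β ^ 2)) s := fun s =>
    contDiffOn_const.div (((hid s).pow 2).add contDiffOn_const) fun z _ => hsum z
  refine solvesExactly_of_homogeneous
    (f := fun z => -(2 / 3 / β ^ 2) - 4 / 3 / β * (Real.arctan (z / β) / z)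
      - 2 / (3 * β ^ 4) * (z ^ 2 * Real.log (z ^ 2 / (z ^ 2 + β ^ 2))))
    (e := fun z => 1 / (z ^ 2 + β ^ 2)) (c := -1) h isOpen_ne_zero
    (mem_fullRange_iff h.q_ne_zero) exists_mem_fullRange ?_ (he _) (fun z _ => by positivity)
    (by norm_num) (fun z hz => ?_) (fun z hz => ?_) (fun u r hur => ?_) (fun u r hur => ?_)
  · refine (contDiffOn_const.sub (contDiffOn_const.mul
      ((Real.contDiff_arctan.comp_contDiffOn ((hid _).div_const β)).div (hid _)
        fun z hz => hz))).sub (contDiffOn_const.mul (((hid _).pow 2).mul ?_))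
    refine (((hid _).pow 2).div (((hid _).pow 2).add contDiffOn_const) fun z _ => hsum z).log
      fun z hz => ?_
    exact div_ne_zero (pow_ne_zero 2 hz) (hsum z)
  · have hz0 : z ≠ 0 := hz
    have h3 : -(-2 * (1 / (z ^ 2 + β ^ 2)) ^ 2) ≠ 0 := by
      rw [neg_mul, neg_neg]; positivity
    have h4 := (hasDerivAt_neg (-2 * (1 / (z ^ 2 + β ^ 2)) ^ 2)).sqrt h3
    have h5 := (((h4.const_mul (α ^ 2)).const_sub 1).log
      (by rw [hX z, hY z]; positivity)).const_mul (-(2 / α ^ 4))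
    have h6 := h5.fun_sub ((h4.const_mul 2).div_const (α ^ 2))
    refine h6.congr_deriv ?_
    rw [hX z, hY z, hα4, hα2]
    field_simp
    ring_nf
    simp [h22]
  · have hz0 : z ≠ 0 := hz
    have ha := (((hasDerivAt_id' z).div_const β).arctan).fun_div (hasDerivAt_id' z) hz0
    have hq2 := (hasDerivAt_id' z).fun_pow 2
    have hl := (hq2.fun_div (hq2.add_const (β ^ 2)) (hsum z)).log (by positivity)
    have h1 := (((ha.const_mul (4 / 3 / β)).const_sub (-(2 / 3 / β ^ 2))).fun_sub
      ((hq2.fun_mul hl).const_mul (2 / (3 * β ^ 4)))).deriv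
    rw [h1, new1L, hX z, hY z, hα4, hα2]
    have hs := hsum z
    have hs' : 1 + (z / β) ^ 2 = (z ^ 2 + β ^ 2) / β ^ 2 := by field_simp; ring
    rw [hs']
    simp only [Nat.cast_ofNat, Nat.add_one_sub_one, pow_one, mul_one]
    generalize Real.log (z ^ 2 / (z ^ 2 + β ^ 2)) = l
    field_simp
    rw [h22]
    ring
  · have := h.q_ne_zero u hur.1
    have h3 : r ^ 2 + q u ^ 2 * β ^ 2 ≠ 0 := by positivity
    have h4 : (r / q u) ^ 2 + β ^ 2 = (r ^ 2 + q u ^ 2 * β ^ 2) / q u ^ 2 := by field_simp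
    rw [new1F, h4]
    field_simp
  · have := hur.2.ne'
    have := h.q_ne_zero u hur.1
    have h3 : r ^ 2 + q u ^ 2 * β ^ 2 ≠ 0 := by positivity
    have h4 : (r / q u) ^ 2 / ((r / q u) ^ 2 + β ^ 2) = r ^ 2 / (r ^ 2 + q u ^ 2 * β ^ 2) := by
      rw [show (r / q u) ^ 2 + β ^ 2 = (r ^ 2 + q u ^ 2 * β ^ 2) / q u ^ 2 by field_simp]
      field_simp
    rw [new1Q, h4, div_div r (q u) β]
    generalize Real.log (r ^ 2 / (r ^ 2 + q u ^ 2 * β ^ 2)) = l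
    generalize Real.arctan (r / (q u * β)) = a
    field_simp
    ring

end models

/-! ### Models with quartic square roots: Born-Infeld and logarithmic -/

section models

variable {Λ u₀ : ℝ} {S : Set (ℝ × ℝ)} {P : ℝ → ℝ → ℝ → ℝ} {m q C₁ : ℝ → ℝ}

/-- The two parameters let one family serve both models: (a, b) = (1, 1/β²) for Born-Infeld and (β²,
1) for the logarithmic Lagrangian. -/
theorem contDiff_sqrt_quartic {a b : ℝ} (ha : 0 ≤ a) (hb : 0 < b) :
    ContDiff ℝ ∞ (fun z : ℝ => Real.sqrt (z ^ 4 * a + b)) :=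
  (((contDiff_id.pow 4).mul contDiff_const).add contDiff_const).sqrt fun z => by
    have : 0 ≤ z ^ 4 * a := by positivity
    simp only [id]
    linarith

theorem sqrt_quartic_pos {a b : ℝ} (ha : 0 ≤ a) (hb : 0 < b) (z : ℝ) :
    0 < Real.sqrt (z ^ 4 * a + b) := by
  have : 0 ≤ z ^ 4 * a := by positivity
  exact Real.sqrt_pos.2 (by linarith)

theorem hasDerivAt_sqrt_quartic {a b : ℝ} (ha : 0 ≤ a) (hb : 0 < b) (z : ℝ) :
    HasDerivAt (fun z : ℝ => Real.sqrt (z ^ 4 * a + b))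
      (2 * a * z ^ 3 / Real.sqrt (z ^ 4 * a + b)) z := by
  have h1 := (((hasDerivAt_id' z).fun_pow 4).mul_const a).add_const b
  refine (h1.sqrt (Real.sqrt_pos.1 (sqrt_quartic_pos ha hb z)).ne').congr_deriv ?_
  have := (sqrt_quartic_pos ha hb z).ne'
  field_simp
  norm_num
  ring

theorem sqrt_quartic_scale (a b t v : ℝ) :
    Real.sqrt ((v * t) ^ 4 * a + v ^ 4 * b) = v ^ 2 * Real.sqrt (t ^ 4 * a + b) := by
  rw [show (v * t) ^ 4 * a + v ^ 4 * b = (v ^ 2) ^ 2 * (t ^ 4 * a + b) by ring,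
    Real.sqrt_mul (by positivity), Real.sqrt_sq (by positivity)]

/-- The radial function `f` of the Born-Infeld solutions `Q = C₁/r + q² f(r/q)`. -/
def bornInfeldRadial (β κ z : ℝ) : ℝ :=
  2 * β ^ 2 / 3 * z ^ 2
    - 2 * β ^ 2 * ((κ + ∫ t in (0 : ℝ)..z, Real.sqrt (t ^ 4 * 1 + 1 / β ^ 2)) / z)

section bornInfeld

variable {β : ℝ} (κ : ℝ)

theorem contDiffOn_bornInfeldRadial (hβ : 0 < β) :
    ContDiffOn ℝ ∞ (bornInfeldRadial β κ) {z | z ≠ 0} := by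
  have hid : ContDiffOn ℝ ∞ (fun z : ℝ => z) {z | z ≠ 0} := contDiffOn_id
  exact (contDiffOn_const.mul (hid.pow 2)).sub (contDiffOn_const.mul
    ((contDiffOn_const.add (contDiff_primitive
      (contDiff_sqrt_quartic zero_le_one (by positivity))).contDiffOn).div hid fun z hz => hz))

theorem deriv_bornInfeldRadial (hβ : 0 < β) {z : ℝ} (hz : z ≠ 0) :
    deriv (bornInfeldRadial β κ) z = 2 * β ^ 2 / 3 * (2 * z)
      - 2 * β ^ 2 * ((Real.sqrt (z ^ 4 * 1 + 1 / β ^ 2) * z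
        - (κ + ∫ t in (0 : ℝ)..z, Real.sqrt (t ^ 4 * 1 + 1 / β ^ 2))) / z ^ 2) := by
  have hI := hasDerivAt_primitive (contDiff_sqrt_quartic (a := 1) (b := 1 / β ^ 2)
    zero_le_one (by positivity)).continuous z
  have h1 := (((hasDerivAt_id' z).fun_pow 2).const_mul (2 * β ^ 2 / 3)).fun_sub
    (((hI.const_add κ).fun_div (hasDerivAt_id' z) hz).const_mul (2 * β ^ 2))
  refine (h1.congr_deriv ?_).deriv
  simp

theorem bornInfeldQ_eq (q C₁ : ℝ → ℝ) {u r : ℝ} (hr : 0 < r) (hq : q u ≠ 0) :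
    bornInfeldQ β κ q C₁ u r = C₁ u / r + q u ^ 2 * bornInfeldRadial β κ (r / q u) := by
  have h1 := integral_eq_cube_mul (w := fun s => Real.sqrt (s ^ 4 + q u ^ 4 / β ^ 2))
    (v := fun t => Real.sqrt (t ^ 4 * 1 + 1 / β ^ 2)) (a := q u) (fun t => by
      rw [← sqrt_quartic_scale]; ring_nf) (r / q u)
  rw [mul_div_cancel₀ r hq] at h1
  rw [bornInfeldQ, h1, bornInfeldRadial]
  field_simp
  ring

theorem solvesExactly_bornInfeld (hβ : 0 < β) (h : AdmissibleData u₀ S P m q C₁) :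
    SolvesExactlyWhenRestricted Λ u₀ (fullRange u₀) S (bornInfeldL β)
      (bornInfeldF β q) (bornInfeldQ β κ q C₁) P m q C₁ := by
  have hb : 0 < 1 / β ^ 2 := by positivity
  have hs0 := sqrt_quartic_pos (b := 1 / β ^ 2) zero_le_one hb
  have hs2 : ∀ z : ℝ, Real.sqrt (z ^ 4 * 1 + 1 / β ^ 2) ^ 2 = z ^ 4 + 1 / β ^ 2 := fun z => by
    rw [Real.sq_sqrt (by positivity), mul_one]
  -- With s = √(z⁴ + 1/β²), the radicand of the Lagrangian is (s² - 1/β²)/s² = (z²/s)², a perfect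
  -- square.
  have hX : ∀ z : ℝ, Real.sqrt (1 + -2 * (1 / Real.sqrt (z ^ 4 * 1 + 1 / β ^ 2)) ^ 2
      / (2 * β ^ 2)) = z ^ 2 / Real.sqrt (z ^ 4 * 1 + 1 / β ^ 2) := fun z => by
    have h1 : 1 + -2 * (1 / Real.sqrt (z ^ 4 * 1 + 1 / β ^ 2)) ^ 2 / (2 * β ^ 2)
        = (z ^ 2 / Real.sqrt (z ^ 4 * 1 + 1 / β ^ 2)) ^ 2 := by
      have h2 : z ^ 4 + 1 / β ^ 2 ≠ 0 := by positivity
      rw [div_pow, div_pow, hs2]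
      field_simp
      ring
    have := hs0 z
    rw [h1, Real.sqrt_sq (by positivity)]
  refine solvesExactly_of_homogeneous (f := bornInfeldRadial β κ)
    (e := fun z => 1 / Real.sqrt (z ^ 4 * 1 + 1 / β ^ 2)) (c := -1) h isOpen_ne_zero
    (mem_fullRange_iff h.q_ne_zero) exists_mem_fullRange (contDiffOn_bornInfeldRadial κ hβ)
    (contDiffOn_const.div (contDiff_sqrt_quartic zero_le_one hb).contDiffOn
      fun z _ => (hs0 z).ne') (fun z _ => by have := hs0 z; positivity)
    (by norm_num) (fun z hz => ?_) (fun z hz => ?_) (fun u r hur => ?_)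
    (fun u r hur => bornInfeldQ_eq κ q C₁ hur.2 (h.q_ne_zero u hur.1))
  · have hz0 : z ≠ 0 := hz
    have hs := hs0 z
    have h1 := ((hasDerivAt_id' (-2 * (1 / Real.sqrt (z ^ 4 * 1 + 1 / β ^ 2)) ^ 2)).div_const
      (2 * β ^ 2)).const_add 1
    have h2 : 1 + -2 * (1 / Real.sqrt (z ^ 4 * 1 + 1 / β ^ 2)) ^ 2 / (2 * β ^ 2) ≠ 0 := fun h0 => by
      have h3 := hX z
      rw [h0, Real.sqrt_zero] at h3
      have : 0 < z ^ 2 / Real.sqrt (z ^ 4 * 1 + 1 / β ^ 2) := by positivity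
      linarith
    refine (((h1.sqrt h2).const_sub 1).const_mul (4 * β ^ 2)).congr_deriv ?_
    rw [hX z]
    field_simp
    norm_num
  · have hz0 : z ≠ 0 := hz
    have hs := (hs0 z).ne'
    have h2 := hs2 z
    rw [deriv_bornInfeldRadial κ hβ hz0, bornInfeldL, hX z, bornInfeldRadial]
    generalize (∫ t in (0 : ℝ)..z, Real.sqrt (t ^ 4 * 1 + 1 / β ^ 2)) = I
    generalize Real.sqrt (z ^ 4 * 1 + 1 / β ^ 2) = s at *
    field_simp at h2 ⊢
    linear_combination (-12 * z) * h2
  · have hqu := h.q_ne_zero u hur.1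
    have h3 : (r / q u) ^ 4 + 1 / β ^ 2 = (r ^ 4 + q u ^ 4 / β ^ 2) / q u ^ 4 := by
      field_simp
    have h4 : r ^ 4 + q u ^ 4 / β ^ 2 ≠ 0 := by positivity
    rw [bornInfeldF, div_pow, hs2, h3]
    field_simp

end bornInfeld

/-- The radial function `f` of the logarithmic solutions `Q = C₁/r + q² f(r/q)`. -/
def logarithmicRadial (β κ z : ℝ) : ℝ :=
  20 / 9 * β ^ 2 * z ^ 2 - 4 * β * Real.sqrt (z ^ 4 * β ^ 2 + 1)
    - 4 / 3 * β ^ 2 * (z ^ 2 *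
      Real.log (2 * β * z ^ 2 * (Real.sqrt (z ^ 4 * β ^ 2 + 1) - β * z ^ 2)))
    + 16 * β ^ 3 / 3 *
      ((κ + ∫ t in (0 : ℝ)..z, t ^ 4 / Real.sqrt (t ^ 4 * β ^ 2 + 1)) / z)

/-- Gives both the positivity of e and, for z ≠ 0, of the argument of the logarithm in the
logarithmic model. -/
theorem sqrt_quartic_sub_pos {β : ℝ} (hβ : 0 ≤ β) (z : ℝ) :
    0 < Real.sqrt (z ^ 4 * β ^ 2 + 1) - β * z ^ 2 := by
  have h3 : 0 ≤ β * z ^ 2 := by positivity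
  rw [sub_pos, Real.lt_sqrt h3]
  nlinarith

theorem contDiff_quartic_div_sqrt (β : ℝ) :
    ContDiff ℝ ∞ (fun t : ℝ => t ^ 4 / Real.sqrt (t ^ 4 * β ^ 2 + 1)) :=
  (contDiff_id.pow 4).div (contDiff_sqrt_quartic (sq_nonneg β) one_pos)
    fun z => (sqrt_quartic_pos (sq_nonneg β) one_pos z).ne'

theorem deriv_logarithmicRadial {β : ℝ} (κ : ℝ) (hβ : 0 < β) {z : ℝ} (hz : z ≠ 0) :
    deriv (logarithmicRadial β κ) z = 40 / 9 * β ^ 2 * z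
      - 4 * β * (2 * β ^ 2 * z ^ 3 / Real.sqrt (z ^ 4 * β ^ 2 + 1))
      - 4 / 3 * β ^ 2 * (2 * z *
          Real.log (2 * β * z ^ 2 * (Real.sqrt (z ^ 4 * β ^ 2 + 1) - β * z ^ 2))
        + z ^ 2 * (2 / z - 2 * β * z / Real.sqrt (z ^ 4 * β ^ 2 + 1)))
      + 16 * β ^ 3 / 3 * ((z ^ 4 / Real.sqrt (z ^ 4 * β ^ 2 + 1) * z
        - (κ + ∫ t in (0 : ℝ)..z, t ^ 4 / Real.sqrt (t ^ 4 * β ^ 2 + 1))) / z ^ 2) := by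
  have hd := sqrt_quartic_sub_pos hβ.le z
  have hs := (sqrt_quartic_pos (sq_nonneg β) one_pos z).ne'
  have hq2 : HasDerivAt (fun z : ℝ => z ^ 2) (2 * z) z := by
    simpa using (hasDerivAt_id' z).fun_pow 2
  have hsd := hasDerivAt_sqrt_quartic (sq_nonneg β) one_pos z
  have hA : HasDerivAt
      (fun z => 2 * β * z ^ 2 * (Real.sqrt (z ^ 4 * β ^ 2 + 1) - β * z ^ 2)) _ z :=
    (hq2.const_mul (2 * β)).fun_mul (hsd.fun_sub (hq2.const_mul β))
  have hl : HasDerivAt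
      (fun z => Real.log (2 * β * z ^ 2 * (Real.sqrt (z ^ 4 * β ^ 2 + 1) - β * z ^ 2)))
      (2 / z - 2 * β * z / Real.sqrt (z ^ 4 * β ^ 2 + 1)) z := by
    refine (hA.log (by positivity)).congr_deriv ?_
    have hd' := hd.ne'
    generalize Real.sqrt (z ^ 4 * β ^ 2 + 1) = s at *
    field_simp
    ring
  have hI := hasDerivAt_primitive (contDiff_quartic_div_sqrt β).continuous z
  have hIz : HasDerivAt (fun z => (κ + ∫ t in (0 : ℝ)..z,
      t ^ 4 / Real.sqrt (t ^ 4 * β ^ 2 + 1)) / z) _ z :=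
    (hI.const_add κ).fun_div (hasDerivAt_id' z) hz
  have h1 := ((hq2.const_mul (20 / 9 * β ^ 2)).fun_sub (hsd.const_mul (4 * β))).fun_sub
    ((hq2.fun_mul hl).const_mul (4 / 3 * β ^ 2))
  have h2 := h1.fun_add (hIz.const_mul (16 * β ^ 3 / 3))
  have h3 : HasDerivAt (logarithmicRadial β κ) _ z := h2
  rw [h3.deriv]
  ring

theorem logarithmicQ_eq (β κ : ℝ) (q C₁ : ℝ → ℝ) {u z : ℝ} (hq : q u ≠ 0) (hz : z ≠ 0) :
    logarithmicQ β κ q C₁ u (q u * z)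
      = C₁ u / (q u * z) + q u ^ 2 * logarithmicRadial β κ z := by
  have h3 := fun t => sqrt_quartic_scale (β ^ 2) 1 t (q u)
  simp only [mul_one] at h3
  have h1 := integral_eq_cube_mul
    (w := fun s => s ^ 4 / Real.sqrt (s ^ 4 * β ^ 2 + q u ^ 4))
    (v := fun t => t ^ 4 / Real.sqrt (t ^ 4 * β ^ 2 + 1)) (a := q u) (fun t => by
      have := (sqrt_quartic_pos (sq_nonneg β) one_pos t).ne'
      rw [h3]
      field_simp) z
  have h4 : (-2 * (q u * z) ^ 4 * β ^ 2
      + 2 * β * (q u * z) ^ 2 * (q u ^ 2 * Real.sqrt (z ^ 4 * β ^ 2 + 1))) / q u ^ 4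
      = 2 * β * z ^ 2 * (Real.sqrt (z ^ 4 * β ^ 2 + 1) - β * z ^ 2) := by
    generalize Real.sqrt (z ^ 4 * β ^ 2 + 1) = s
    field_simp
    ring
  rw [logarithmicQ, h1, h3, h4, logarithmicRadial]
  generalize Real.log (2 * β * z ^ 2 * (Real.sqrt (z ^ 4 * β ^ 2 + 1) - β * z ^ 2)) = l
  generalize Real.sqrt (z ^ 4 * β ^ 2 + 1) = s
  generalize (∫ t in (0 : ℝ)..z, t ^ 4 / Real.sqrt (t ^ 4 * β ^ 2 + 1)) = I
  clear h1 h3 h4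
  generalize q u = v at *
  field_simp
  ring

theorem solvesExactly_logarithmic {β : ℝ} (κ : ℝ) (hβ : 0 < β)
    (h : AdmissibleData u₀ S P m q C₁) :
    SolvesExactlyWhenRestricted Λ u₀ (fullRange u₀) S (logarithmicL β)
      (logarithmicF β q) (logarithmicQ β κ q C₁) P m q C₁ := by
  have hβ2 : 0 ≤ β ^ 2 := sq_nonneg β
  have hs0 := sqrt_quartic_pos hβ2 one_pos
  have hs2 : ∀ z : ℝ, Real.sqrt (z ^ 4 * β ^ 2 + 1) ^ 2 = z ^ 4 * β ^ 2 + 1 := fun z =>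
    Real.sq_sqrt (by positivity)
  have hd0 := sqrt_quartic_sub_pos hβ.le
  -- Writing s for the root, s² = β² z⁴ + 1 turns 1 - (s - β z²)² into 2 β z² (s - β z²). So 1 +
  -- F/(8β²) is z² e, and 𝓛_F = -1/(z² e).
  have hX : ∀ z : ℝ, 1 + -2 * (2 * β * (Real.sqrt (z ^ 4 * β ^ 2 + 1) - β * z ^ 2)) ^ 2
      / (8 * β ^ 2) = 2 * β * z ^ 2 * (Real.sqrt (z ^ 4 * β ^ 2 + 1) - β * z ^ 2) := fun z => by
    have h1 := hs2 z
    generalize Real.sqrt (z ^ 4 * β ^ 2 + 1) = s at *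
    field_simp
    linear_combination (-8) * h1
  have hid : ContDiffOn ℝ ∞ (fun z : ℝ => z) {z | z ≠ 0} := contDiffOn_id
  have hsq : ContDiff ℝ ∞ (fun z : ℝ => Real.sqrt (z ^ 4 * β ^ 2 + 1)) :=
    contDiff_sqrt_quartic hβ2 one_pos
  have hdiff : ContDiff ℝ ∞ (fun z : ℝ => Real.sqrt (z ^ 4 * β ^ 2 + 1) - β * z ^ 2) :=
    hsq.sub (contDiff_const.mul (contDiff_id.pow 2))
  have hw := contDiff_quartic_div_sqrt β
  refine solvesExactly_of_homogeneous (f := logarithmicRadial β κ)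
    (e := fun z => 2 * β * (Real.sqrt (z ^ 4 * β ^ 2 + 1) - β * z ^ 2)) (c := -1) h isOpen_ne_zero
    (mem_fullRange_iff h.q_ne_zero) exists_mem_fullRange ?_
    (contDiff_const.mul hdiff).contDiffOn (fun z _ => by have := hd0 z; positivity)
    (by norm_num) (fun z hz => ?_) (fun z hz => ?_) (fun u r hur => ?_) (fun u r hur => ?_)
  · refine (((contDiffOn_const.mul (hid.pow 2)).sub (contDiffOn_const.mul hsq.contDiffOn)).sub
      (contDiffOn_const.mul ((hid.pow 2).mul
        (((contDiffOn_const.mul (hid.pow 2)).mul hdiff.contDiffOn).log fun z hz => ?_)))).add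
      (contDiffOn_const.mul ((contDiffOn_const.add (contDiff_primitive hw).contDiffOn).div hid
        fun z hz => hz))
    have hz0 : z ≠ 0 := hz
    have := hd0 z
    positivity
  · have hz0 : z ≠ 0 := hz
    have hd := hd0 z
    have h1 := ((hasDerivAt_id'
      (-2 * (2 * β * (Real.sqrt (z ^ 4 * β ^ 2 + 1) - β * z ^ 2)) ^ 2)).div_const
      (8 * β ^ 2)).const_add 1
    refine ((h1.log (by rw [hX z]; positivity)).const_mul (-8 * β ^ 2)).congr_deriv ?_
    rw [hX z]
    generalize Real.sqrt (z ^ 4 * β ^ 2 + 1) - β * z ^ 2 = d at *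
    field_simp
  · have hz0 : z ≠ 0 := hz
    have hd := (hd0 z).ne'
    have hs := (hs0 z).ne'
    rw [deriv_logarithmicRadial κ hβ hz0, logarithmicL, hX z, logarithmicRadial]
    generalize (∫ t in (0 : ℝ)..z, t ^ 4 / Real.sqrt (t ^ 4 * β ^ 2 + 1)) = I
    generalize Real.log (2 * β * z ^ 2 * (Real.sqrt (z ^ 4 * β ^ 2 + 1) - β * z ^ 2)) = l
    generalize Real.sqrt (z ^ 4 * β ^ 2 + 1) = s at *
    field_simp
    ring
  · have hqu := h.q_ne_zero u hur.1
    have h3 := sqrt_quartic_scale (β ^ 2) 1 (r / q u) (q u)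
    rw [mul_div_cancel₀ r hqu, mul_one] at h3
    rw [logarithmicF, mul_comm (β ^ 2), h3]
    field_simp
    ring
  · have hqu := h.q_ne_zero u hur.1
    have h1 := logarithmicQ_eq β κ q C₁ hqu (div_ne_zero hur.2.ne' hqu)
    rwa [mul_div_cancel₀ r hqu] at h1

end models

/-! ### The Born-Infeld constraint -/

section constraint

variable {u₀ : ℝ} {S B : Set (ℝ × ℝ)} {P : ℝ → ℝ → ℝ → ℝ} {m q C₁ f : ℝ → ℝ}
  {Q : ℝ → ℝ → ℝ} {Z : Set ℝ}

/-- Euler's identity again: C₁/r has degree -1 in r and yields the first summand, q² f(r/q) has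
degree 2 in (r, q) and yields the second. The number w stands for (ln P)_u. -/
theorem constraint_lhs_eq (h : AdmissibleData u₀ S P m q C₁) (hBo : IsOpen B)
    (hB : ∀ u r, (u, r) ∈ B → u₀ < u ∧ 0 < r ∧ r / q u ∈ Z) (hZo : IsOpen Z)
    (hf : ContDiffOn ℝ ∞ f Z)
    (hQ : ∀ u r, (u, r) ∈ B → Q u r = C₁ u / r + q u ^ 2 * f (r / q u))
    {u r : ℝ} (hur : (u, r) ∈ B) (w : ℝ) :
    w * (r * deriv (fun s => Q u s) r - 2 * Q u r) + deriv (fun v => Q v r) u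
      = (deriv C₁ u - 3 * C₁ u * w) / r
        + (deriv q u - q u * w) * (2 * q u * f (r / q u) - r * deriv f (r / q u)) := by
  obtain ⟨⟨x, y⟩, hxy⟩ := h.nonempty
  have hDo : IsOpen (domain B S) := isOpen_domain hBo h.isOpen
  have hp : (![u, r, x, y] : Fin 4 → ℝ) ∈ domain B S := ⟨hur, hxy⟩
  obtain ⟨hu, hr, hZ⟩ := hB u r hur
  -- Q itself is a `potential` with Λ = 0 and mass -C₁/2, so the derivatives already computed apply.
  have hV : ∀ z ∈ domain B S, Q (z 0) (z 1) = potential 0 (fun u => -C₁ u / 2) q f z := by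
    intro z hz
    rw [hQ _ _ hz.1, potential]
    ring
  have hM : ContDiffOn ℝ ∞ (fun u => -C₁ u / 2) (Set.Ioi u₀) := h.smooth_C₁.neg.div_const 2
  have hpd := fun i => (pd_congr_of_isOpen hDo hV hp i).trans
    (pd_potential (Λ := 0) hM h.smooth_q h.q_ne_zero hZo hf hu hr hZ i)
  have h0 := hpd 0
  have h1 := hpd 1
  simp [pd] at h0 h1
  have hr0 := hr.ne'
  rw [h0, h1, hQ u r hur]
  field_simp
  ring

/-- Multiplied by r = q z, the constraint at fixed (u, x, y) says A + d (3 (κ + I(z)) - z s(z)) = 0,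
with s = √(z⁴ + 1/β²), I its integral from 0, A = C₁_u - 3 C₁ w and d a nonzero multiple of q_u - q
w. The bracket has derivative 2 (s² - z⁴)/s = 2/(β² s), which never vanishes, so d = 0 and then A =
0. -/
theorem bornInfeld_constraint_iff {β : ℝ} (κ : ℝ) (hβ : 0 < β)
    (h : AdmissibleData u₀ S P m q C₁) :
    Constraint (fullRange u₀) S P (bornInfeldQ β κ q C₁) ↔
      ∀ u x y, u₀ < u → (x, y) ∈ S →
        deriv q u = q u * logPu P u x y ∧ deriv C₁ u = 3 * C₁ u * logPu P u x y := by
  have hBo := isOpen_of_ratio h.smooth_q h.q_ne_zero isOpen_ne_zero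
    (mem_fullRange_iff (u₀ := u₀) h.q_ne_zero)
  have hlhs := fun u r (hur : (u, r) ∈ fullRange u₀) w =>
    constraint_lhs_eq h hBo (fun u r => (mem_fullRange_iff h.q_ne_zero u r).1) isOpen_ne_zero
      (contDiffOn_bornInfeldRadial κ hβ)
      (fun u r hur => bornInfeldQ_eq κ q C₁ hur.2 (h.q_ne_zero u hur.1)) hur w
  constructor
  · intro H u x y hu hxy
    have hq0 := h.q_ne_zero u hu
    have hs := contDiff_sqrt_quartic (a := 1) (b := 1 / β ^ 2) zero_le_one (by positivity)
    set w := logPu P u x y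
    set A := deriv C₁ u - 3 * C₁ u * w with hA
    set d := -2 * β ^ 2 * q u ^ 2 * (deriv q u - q u * w) with hd
    have key : ∀ z, 0 < q u * z → A + d * (3 * (κ + ∫ t in (0 : ℝ)..z,
        Real.sqrt (t ^ 4 * 1 + 1 / β ^ 2)) - z * Real.sqrt (z ^ 4 * 1 + 1 / β ^ 2)) = 0 := by
      intro z hz
      have hz0 : z ≠ 0 := fun h0 => by simp [h0] at hz
      have hur : (u, q u * z) ∈ fullRange u₀ := ⟨hu, hz⟩
      have h1 := H u (q u * z) x y hur hxy
      rw [hlhs _ _ hur, mul_div_cancel_left₀ z hq0, deriv_bornInfeldRadial κ hβ hz0,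
        bornInfeldRadial] at h1
      rw [hd]
      change A / _ + _ = _ at h1
      generalize (∫ t in (0 : ℝ)..z, Real.sqrt (t ^ 4 * 1 + 1 / β ^ 2)) = I at *
      generalize Real.sqrt (z ^ 4 * 1 + 1 / β ^ 2) = s at *
      change A / (q u * z) + (deriv q u - q u * w) * _ = _ at h1
      generalize deriv q u - q u * w = D at *
      clear_value A
      field_simp at h1
      linear_combination h1 / 3
    -- This is the point r = 1; any r > 0 would do, since the relation holds on a neighbourhood and
    -- only its derivative at one point is needed.
    set z₀ := 1 / q u with hz₀
    have hpos : 0 < q u * z₀ := by rw [hz₀, mul_one_div_cancel hq0]; exact one_pos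
    have hev : (fun z => A + d * (3 * (κ + ∫ t in (0 : ℝ)..z,
        Real.sqrt (t ^ 4 * 1 + 1 / β ^ 2)) - z * Real.sqrt (z ^ 4 * 1 + 1 / β ^ 2)))
        =ᶠ[𝓝 z₀] fun _ => 0 := by
      have hc : ContinuousAt (fun z => q u * z) z₀ := by fun_prop
      filter_upwards [continuousAt_const.eventually_lt hc hpos] with z hz using key z hz
    have hI := hasDerivAt_primitive hs.continuous z₀
    have h1 := (((((hI.const_add κ).const_mul 3).fun_sub ((hasDerivAt_id' z₀).fun_mul
      (hasDerivAt_sqrt_quartic (a := 1) (b := 1 / β ^ 2) zero_le_one (by positivity) z₀))).const_mul d).const_add A)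
    have h2 := h1.unique ((hasDerivAt_const z₀ (0 : ℝ)).congr_of_eventuallyEq hev)
    have hs0 := sqrt_quartic_pos (a := 1) (b := 1 / β ^ 2) zero_le_one (by positivity) z₀
    have hs2 : Real.sqrt (z₀ ^ 4 * 1 + 1 / β ^ 2) ^ 2 = z₀ ^ 4 * 1 + 1 / β ^ 2 :=
      Real.sq_sqrt (by positivity)
    have h3 : d = 0 := by
      rcases mul_eq_zero.1 h2 with h3 | h3
      · exact h3
      · exfalso
        clear h1 h2 hev key
        clear_value z₀
        generalize Real.sqrt (z₀ ^ 4 * 1 + 1 / β ^ 2) = s at *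
        field_simp at h3 hs2
        -- A vanishing derivative of the bracket would force s² = z₀⁴, against s² = z₀⁴ + 1/β².
        have h4 : s ^ 2 = z₀ ^ 4 := by linarith
        rw [h4] at hs2
        linarith
    have h4 : deriv q u - q u * w = 0 := by
      have h5 : -2 * β ^ 2 * q u ^ 2 ≠ 0 := by
        have := hβ.ne'
        simp [this, hq0]
      exact (mul_eq_zero.1 h3).resolve_left h5
    have h5 := key z₀ hpos
    rw [h3, zero_mul, add_zero] at h5
    exact ⟨sub_eq_zero.1 h4, sub_eq_zero.1 h5⟩
  · intro H u r x y hur hxy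
    obtain ⟨h1, h2⟩ := H u x y hur.1 hxy
    rw [hlhs u r hur, h1, h2, sub_self, sub_self, zero_div, zero_mul, add_zero]

theorem bornInfeld_constraint_iff_exists {β : ℝ} (κ : ℝ) (hβ : 0 < β)
    (h : AdmissibleData u₀ S P m q C₁) :
    Constraint (fullRange u₀) S P (bornInfeldQ β κ q C₁) ↔
      ChargeRestriction u₀ S P q ∧
        ∃ κ' : ℝ, ∀ u r, u₀ < u → 0 < r →
          bornInfeldQ β κ q C₁ u r = bornInfeldQ β κ' q (fun _ => 0) u r := by
  rw [chargeRestriction_iff h]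
  constructor
  · intro H
    rw [bornInfeld_constraint_iff κ hβ h] at H
    refine ⟨fun u x y hu hxy => (H u x y hu hxy).1, ?_⟩
    obtain ⟨⟨x, y⟩, hxy⟩ := h.nonempty
    -- C₁ and q³ have the same logarithmic rate 3 (ln P)_u, so their quotient is constant on the
    -- connected half-line.
    have hder : ∀ u, u₀ < u → HasDerivAt (fun u => C₁ u / q u ^ 3) 0 u := by
      intro u hu
      have hq0 := h.q_ne_zero u hu
      have hq := hasDerivAt_of_contDiffOn isOpen_Ioi h.smooth_q (x := u) hu
      have hC := hasDerivAt_of_contDiffOn isOpen_Ioi h.smooth_C₁ (x := u) hu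
      refine (hC.fun_div (hq.fun_pow 3) (pow_ne_zero 3 hq0)).congr_deriv ?_
      rw [(H u x y hu hxy).1, (H u x y hu hxy).2]
      field_simp
      norm_num
    obtain ⟨k, hk⟩ := isOpen_Ioi.exists_is_const_of_deriv_eq_zero (s := Set.Ioi u₀)
      isPreconnected_Ioi (fun u hu => (hder u hu).differentiableAt.differentiableWithinAt)
      (fun u hu => (hder u hu).deriv)
    -- Since C₁ = k q³, the term k q³/r merges with -2β² κ q³/r; this shift of κ is the result.
    refine ⟨κ - k / (2 * β ^ 2), fun u r hu hr => ?_⟩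
    have hC : C₁ u = k * q u ^ 3 := by
      rw [← hk u hu]
      have := h.q_ne_zero u hu
      field_simp
    simp only [bornInfeldQ]
    rw [hC]
    have := hβ.ne'
    field_simp
    ring
  · rintro ⟨hch, κ', hκ'⟩
    -- With C₁ = 0 the condition on C₁ is trivial, so the charge restriction alone gives the
    -- constraint for κ'. It transfers to the original Q because the two functions agree on an open
    -- range.
    have h0 : AdmissibleData u₀ S P m q (fun _ => 0) := { h with smooth_C₁ := contDiffOn_const }
    have H := (bornInfeld_constraint_iff κ' hβ h0).2 fun u x y hu hxy =>
      ⟨hch u x y hu hxy, by simp⟩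
    intro u r x y hur hxy
    have h1 := H u r x y hur hxy
    have e1 : deriv (fun s => bornInfeldQ β κ q C₁ u s) r
        = deriv (fun s => bornInfeldQ β κ' q (fun _ => 0) u s) r :=
      EventuallyEq.deriv_eq (by
        filter_upwards [lt_mem_nhds hur.2] with s hs using hκ' u s hur.1 hs)
    have e2 : deriv (fun v => bornInfeldQ β κ q C₁ v r) u
        = deriv (fun v => bornInfeldQ β κ' q (fun _ => 0) v r) u :=
      EventuallyEq.deriv_eq (by
        filter_upwards [lt_mem_nhds hur.1] with v hv using hκ' v r hv hur.2)
    rw [e1, e2, hκ' u r hur.1 hur.2]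
    exact h1

/-- The contribution of C₁ to the Robinson-Trautman expression is 2 C₁_u - 6 C₁ (ln P)_u, which the
constraint makes zero. -/
theorem rtEquation_iff_of_bornInfeld_constraint {β : ℝ} (κ : ℝ) (hβ : 0 < β)
    (h : AdmissibleData u₀ S P m q C₁)
    (H : Constraint (fullRange u₀) S P (bornInfeldQ β κ q C₁)) :
    RTEquation u₀ S P (fun u => m u - C₁ u / 2) ↔ RTEquation u₀ S P m := by
  rw [bornInfeld_constraint_iff κ hβ h] at H
  refine forall₃_congr fun u x y => forall₂_congr fun hu hxy => ?_
  have hm := hasDerivAt_of_contDiffOn isOpen_Ioi h.smooth_m (x := u) hu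
  have hC := hasDerivAt_of_contDiffOn isOpen_Ioi h.smooth_C₁ (x := u) hu
  rw [(hm.fun_sub (hC.div_const 2)).deriv, (H u x y hu hxy).2]
  ring_nf

end constraint

end RobinsonTrautman

end

open RobinsonTrautman in
theorem mainTheorem2 (Λ u₀ : ℝ) (S : Set (ℝ × ℝ)) (P : ℝ → ℝ → ℝ → ℝ) (m q C₁ : ℝ → ℝ)
    (hdata : AdmissibleData u₀ S P m q C₁) :
    -- Maxwell
    SolvesExactlyWhenRestricted Λ u₀ (fullRange u₀) S maxwellL
      (maxwellF q) (maxwellQ q C₁) P m q C₁ ∧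
    -- Born-Infeld
    (∀ β κ : ℝ, 0 < β →
      SolvesExactlyWhenRestricted Λ u₀ (fullRange u₀) S (bornInfeldL β)
        (bornInfeldF β q) (bornInfeldQ β κ q C₁) P m q C₁ ∧
      (Constraint (fullRange u₀) S P (bornInfeldQ β κ q C₁) ↔
        ChargeRestriction u₀ S P q ∧
        ∃ κ' : ℝ, ∀ u r, u₀ < u → 0 < r →
          bornInfeldQ β κ q C₁ u r = bornInfeldQ β κ' q (fun _ => 0) u r) ∧
      (Constraint (fullRange u₀) S P (bornInfeldQ β κ q C₁) →
        (RTEquation u₀ S P (fun u => m u - C₁ u / 2) ↔ RTEquation u₀ S P m))) ∧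
    -- logarithmic Lagrangian
    (∀ β κ : ℝ, 0 < β →
      SolvesExactlyWhenRestricted Λ u₀ (fullRange u₀) S (logarithmicL β)
        (logarithmicF β q) (logarithmicQ β κ q C₁) P m q C₁) ∧
    -- New Lagrangian 1
    (∀ α β : ℝ, 0 < α → 0 < β → β ^ 2 = Real.sqrt 2 * α ^ 2 →
      SolvesExactlyWhenRestricted Λ u₀ (fullRange u₀) S (new1L α)
        (new1F β q) (new1Q β q C₁) P m q C₁) ∧
    -- New Lagrangian 2
    (∀ β : ℝ, 0 < β → (∀ u, u₀ < u → 0 < q u) →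
      SolvesExactlyWhenRestricted Λ u₀ (innerRange u₀ β q) S (new2L β)
        (new2F β q) (new2Q β q C₁) P m q C₁) :=
  ⟨solvesExactly_maxwell hdata,
    fun _ κ hβ => ⟨solvesExactly_bornInfeld κ hβ hdata,
      bornInfeld_constraint_iff_exists κ hβ hdata,
      rtEquation_iff_of_bornInfeld_constraint κ hβ hdata⟩,
    fun _ κ hβ => solvesExactly_logarithmic κ hβ hdata,
    fun _ _ _ hβ hαβ => solvesExactly_new1 hβ hαβ hdata,
    fun _ hβ hq => solvesExactly_new2 hβ hdata hq⟩
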